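/- Let $\alpha\in\mathbb R$, let $\mathbb T=\{z\in\mathbb C : |z|=1\}$ with normalised Haar measure $m$, and for $\beta\in\mathbb R$ let $R_\beta z=e^{2\pi i\beta}z$ on $\mathbb T$. Let $\mathbb A_\alpha$ be the noncommutative $2$-torus, i.e. the universal unital $C^*$-algebra generated by two unitaries $U,V$ with $UV=e^{2\pi i\alpha}VU$, and let $\tau$ be its canonical trace, the state with $\tau(U^mV^n)=\delta_{m,0}\delta_{n,0}$ for $m,n\in\mathbb Z$. Let $\theta\in\mathbb R$ be such that $\theta/2\pi$ is irrational and let $f:\mathbb T\to\mathbb T$ be continuous. Let $\Phi_{\theta,f}$ be the Anzai skew-product, i.e. the $*$-automorphism of $\mathbb A_\alpha$ determined by $$\Phi_{\theta,f}(U)=e^{i\theta}U,\qquad \Phi_{\theta,f}(V)=f(U)V,$$ where $f(U)$ is given by the continuous functional calculus. For $n\in\mathbb Z$ define $f_n:\mathbb T\to\mathbb T$ by $$f_n(z)=\prod_{l=0}^{n-1}f(R_{-l\alpha}z)\ \ (n>0),\qquad f_0(z)=1,\qquad f_n(z)=\prod_{l=1}^{|n|}\overline{f(R_{l\alpha}z)}\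 \ (n<0).$$ Then the $C^*$-dynamical system $(\mathbb A_\alpha,\Phi_{\theta,f},\tau)$ is ergodic, i.e. $\tau$ is an extreme point of the convex set of $\Phi_{\theta,f}$-invariant states of $\mathbb A_\alpha$, if and only if, for every $n\in\mathbb Z\setminus\{0\}$, the cohomological equation $$(g\circ R_{\theta/2\pi})\,f_n=g\qquad m\text{-almost everywhere}$$ has no nonzero solution $g\in L^2(\mathbb T,m)$. -/

import Mathlib

open scoped ENNReal ComplexOrder ComplexConjugate InnerProductSpace

noncomputable section

namespace NCTorus

/-! ### The universal C⋆-algebra of the noncommutative 2-torus -/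

/-- `u, v` are unitaries of the unital C⋆-algebra `B` with `u v = e^{2πiα} v u`. -/
structure IsTorusPair (α : ℝ) {B : Type*} [CStarAlgebra B] (u v : B) : Prop where
  u_mem : u ∈ unitary B
  v_mem : v ∈ unitary B
  comm : u * v = Complex.exp (2 * Real.pi * Complex.I * α) • (v * u)

/-- A representation of the defining relations in a (nonzero) unital C⋆-algebra. -/
structure TorusRep (α : ℝ) : Type 1 where
  carrier : Type
  [cstar : CStarAlgebra carrier]
  [nontriv : Nontrivial carrier]
  u : carrier
  v : carrier
  pair : IsTorusPair α u v

attribute [instance] TorusRep.cstar TorusRep.nontriv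

/-- The C⋆-algebra of bounded families indexed by all representations of the relations. -/
abbrev Ambient (α : ℝ) : Type 1 := lp (fun i : TorusRep α => i.carrier) ∞

instance instCStarAlgebraAmbient (α : ℝ) : CStarAlgebra (Ambient α) where

theorem norm_le_one_of_unitary {B : Type*} [CStarAlgebra B] {u : B} (hu : u ∈ unitary B) :
    ‖u‖ ≤ 1 := by
  rcases subsingleton_or_nontrivial B with h | h
  · simp [Subsingleton.elim u 0]
  · exact (CStarRing.norm_of_mem_unitary hu).le

/-- The family of all first generators. -/
def ambientU (α : ℝ) : Ambient α :=
  ⟨fun i => i.u, memℓp_infty ⟨1, by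
    rintro _ ⟨i, rfl⟩; exact norm_le_one_of_unitary i.pair.u_mem⟩⟩

/-- The family of all second generators. -/
def ambientV (α : ℝ) : Ambient α :=
  ⟨fun i => i.v, memℓp_infty ⟨1, by
    rintro _ ⟨i, rfl⟩; exact norm_le_one_of_unitary i.pair.v_mem⟩⟩

/-- The closed unital ⋆-subalgebra generated by the two universal generators. -/
def torusSubalgebra (α : ℝ) : StarSubalgebra ℂ (Ambient α) :=
  (StarAlgebra.adjoin ℂ {ambientU α, ambientV α}).topologicalClosure

end NCTorus

/-- The noncommutative 2-torus `𝔸_α`: the universal unital C⋆-algebra generated by two unitaries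
`U, V` with `U V = e^{2πiα} V U`. It is realised as the C⋆-algebra generated by the universal pair
inside the product of all representations of the relations; `NCTorus.existsUnique_lift` is its
universal property. -/
def NCTorus (α : ℝ) : Type 1 := NCTorus.torusSubalgebra α

namespace NCTorus

instance instCStarAlgebra (α : ℝ) : CStarAlgebra (NCTorus α) :=
  StarSubalgebra.cstarAlgebra (torusSubalgebra α)
    (h_closed := StarSubalgebra.isClosed_topologicalClosure _)

/-- The first universal generator. -/
def U (α : ℝ) : NCTorus α :=
  ⟨ambientU α, StarSubalgebra.le_topologicalClosure _
    (StarAlgebra.subset_adjoin ℂ _ (by simp))⟩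

/-- The second universal generator. -/
def V (α : ℝ) : NCTorus α :=
  ⟨ambientV α, StarSubalgebra.le_topologicalClosure _
    (StarAlgebra.subset_adjoin ℂ _ (by simp))⟩

theorem pair_UV (α : ℝ) : IsTorusPair α (U α) (V α) where
  u_mem := by
    rw [Unitary.mem_iff]
    constructor
    · apply Subtype.ext; apply lp.ext; funext i; exact (Unitary.mem_iff.mp i.pair.u_mem).1
    · apply Subtype.ext; apply lp.ext; funext i; exact (Unitary.mem_iff.mp i.pair.u_mem).2
  v_mem := by
    rw [Unitary.mem_iff]
    constructor
    · apply Subtype.ext; apply lp.ext; funext i; exact (Unitary.mem_iff.mp i.pair.v_mem).1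
    · apply Subtype.ext; apply lp.ext; funext i; exact (Unitary.mem_iff.mp i.pair.v_mem).2
  comm := by
    apply Subtype.ext; apply lp.ext; funext i; exact i.pair.comm

/-- Evaluation of an element of the torus at a representation. -/
def eval {α : ℝ} (i : TorusRep α) : NCTorus α →⋆ₐ[ℂ] i.carrier where
  toFun x := x.1 i
  map_one' := rfl
  map_mul' _ _ := rfl
  map_zero' := rfl
  map_add' _ _ := rfl
  commutes' _ := rfl
  map_star' _ := rfl

theorem continuous_starAlgHom {A B : Type*} [CStarAlgebra A] [CStarAlgebra B]
    (φ : A →⋆ₐ[ℂ] B) : Continuous φ :=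
  AddMonoidHomClass.continuous_of_bound φ 1 (by
    simpa only [one_mul] using NonUnitalStarAlgHom.norm_apply_le φ)

/-- A ⋆-homomorphism on the torus is determined by its values on the two generators. -/
theorem hom_ext {α : ℝ} {B : Type*} [CStarAlgebra B] {φ ψ : NCTorus α →⋆ₐ[ℂ] B}
    (hU : φ (U α) = ψ (U α)) (hV : φ (V α) = ψ (V α)) : φ = ψ := by
  refine StarAlgHom.ext_topologicalClosure (S := StarAlgebra.adjoin ℂ {ambientU α, ambientV α})
    (continuous_starAlgHom φ) (continuous_starAlgHom ψ) ?_
  refine StarAlgHom.ext_adjoin ?_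
  rintro ⟨x, hx⟩ hx'
  rcases hx' with rfl | rfl
  · exact hU
  · exact hV

theorem exists_small_model (C : Type*) [CStarAlgebra C] [Small.{0} C] :
    ∃ (X : Type) (_ : CStarAlgebra X), Nonempty (X ≃⋆ₐ[ℂ] C) := by
  let e : Shrink.{0} C ≃ₐ[ℂ] C := Shrink.algEquiv ℂ C
  let nr : NormedRing (Shrink.{0} C) := NormedRing.induced _ C e e.injective
  let na : NormedAlgebra ℂ (Shrink.{0} C) := NormedAlgebra.induced ℂ (Shrink.{0} C) C e
  let sr : StarRing (Shrink.{0} C) :=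
    { star := fun x => e.symm (star (e x))
      star_involutive := fun x => by simp
      star_mul := fun x y => by simp
      star_add := fun x y => by simp }
  have hstar : ∀ x : Shrink.{0} C, e (star x) = star (e x) := fun x => e.apply_symm_apply _
  have hiso : Isometry e := Isometry.of_dist_eq fun _ _ => rfl
  have cs : CompleteSpace (Shrink.{0} C) :=
    (IsometryEquiv.mk e.toEquiv hiso).completeSpace
  have cr : CStarRing (Shrink.{0} C) :=
    ⟨fun x => by
      change ‖e x‖ * ‖e x‖ ≤ ‖e (star x * x)‖
      rw [map_mul, hstar, CStarRing.norm_star_mul_self]⟩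
  have sm : StarModule ℂ (Shrink.{0} C) := ⟨fun c x => e.injective (by simp [hstar])⟩
  exact ⟨Shrink.{0} C, { }, ⟨StarAlgEquiv.ofAlgEquiv e hstar⟩⟩

theorem small_closure_adjoin {B : Type*} [CStarAlgebra B] (u v : B) :
    Small.{0} (StarAlgebra.adjoin ℂ {u, v}).topologicalClosure := by
  have hset : ({u, v} ∪ star {u, v} : Set B) = Set.range ![u, v, star u, star v] := by
    ext x
    simp only [Set.mem_union, Set.mem_insert_iff, Set.mem_singleton_iff, Set.mem_star,
      Set.mem_range, Fin.exists_fin_succ, star_eq_iff_star_eq]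
    simp [eq_comm, or_assoc]
  have h1 : Small.{0} ((StarAlgebra.adjoin ℂ {u, v} : StarSubalgebra ℂ B) : Set B) := by
    have : ((StarAlgebra.adjoin ℂ {u, v} : StarSubalgebra ℂ B) : Set B)
        = Set.range (FreeAlgebra.lift ℂ ![u, v, star u, star v]) := by
      rw [← AlgHom.coe_range, ← Algebra.adjoin_range_eq_range_freeAlgebra_lift, ← hset]
      rfl
    rw [this]
    exact small_range _
  refine @small_subset _ _ _ ?_ (small_range.{0} fun x : ℕ →
    ((StarAlgebra.adjoin ℂ {u, v} : StarSubalgebra ℂ B) : Set B) =>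
      Filter.limUnder Filter.atTop fun n => (x n : B))
  intro y hy
  obtain ⟨x, hx, hlim⟩ := mem_closure_iff_seq_limit.mp hy
  exact ⟨fun n => ⟨x n, hx n⟩, hlim.limUnder_eq⟩

/-- The universal property of the noncommutative 2-torus. -/
theorem existsUnique_lift {α : ℝ} {B : Type*} [CStarAlgebra B] {u v : B}
    (h : IsTorusPair α u v) :
    ∃! φ : NCTorus α →⋆ₐ[ℂ] B, φ (U α) = u ∧ φ (V α) = v := by
  refine existsUnique_of_exists_of_unique ?_ fun φ ψ hφ hψ =>
    hom_ext (hφ.1.trans hψ.1.symm) (hφ.2.trans hψ.2.symm)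
  rcases subsingleton_or_nontrivial B with hB | hB
  · exact ⟨{ toFun := fun _ => 0
             map_one' := Subsingleton.elim _ _
             map_mul' := fun _ _ => Subsingleton.elim _ _
             map_zero' := rfl
             map_add' := fun _ _ => Subsingleton.elim _ _
             commutes' := fun _ => Subsingleton.elim _ _
             map_star' := fun _ => Subsingleton.elim _ _ },
      Subsingleton.elim _ _, Subsingleton.elim _ _⟩
  let S : StarSubalgebra ℂ B := (StarAlgebra.adjoin ℂ {u, v}).topologicalClosure
  have hS : IsClosed (S : Set B) := StarSubalgebra.isClosed_topologicalClosure _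
  let _ : CStarAlgebra S := StarSubalgebra.cstarAlgebra S (h_closed := hS)
  have hu : u ∈ S := StarSubalgebra.le_topologicalClosure _ (StarAlgebra.subset_adjoin ℂ _ (by simp))
  have hv : v ∈ S := StarSubalgebra.le_topologicalClosure _ (StarAlgebra.subset_adjoin ℂ _ (by simp))
  have : Small.{0} S := small_closure_adjoin u v
  obtain ⟨X, hX, ⟨e⟩⟩ := exists_small_model S
  let incl : X →⋆ₐ[ℂ] B := S.subtype.comp (e : X →⋆ₐ[ℂ] S)
  have hincl : Function.Injective incl := fun x y hxy => e.injective (Subtype.ext hxy)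
  have : Nontrivial X := ⟨⟨0, 1, fun h01 => zero_ne_one (α := B) (by
    simpa using congrArg incl h01)⟩⟩
  let u' : X := e.symm ⟨u, hu⟩
  let v' : X := e.symm ⟨v, hv⟩
  have hu' : incl u' = u := congrArg Subtype.val (e.apply_symm_apply ⟨u, hu⟩)
  have hv' : incl v' = v := congrArg Subtype.val (e.apply_symm_apply ⟨v, hv⟩)
  have hp : IsTorusPair α u' v' :=
    { u_mem := by
        rw [Unitary.mem_iff]
        constructor <;> apply hincl <;> simp only [map_mul, map_star, map_one, hu']
        · exact (Unitary.mem_iff.mp h.u_mem).1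
        · exact (Unitary.mem_iff.mp h.u_mem).2
      v_mem := by
        rw [Unitary.mem_iff]
        constructor <;> apply hincl <;> simp only [map_mul, map_star, map_one, hv']
        · exact (Unitary.mem_iff.mp h.v_mem).1
        · exact (Unitary.mem_iff.mp h.v_mem).2
      comm := by
        apply hincl
        rw [map_smul, map_mul, map_mul, hu', hv']
        exact h.comm }
  exact ⟨incl.comp (eval ⟨X, u', v', hp⟩), hu', hv'⟩

/-- The ⋆-homomorphism out of `𝔸_α` induced by a pair satisfying the relations. -/
def lift {α : ℝ} {B : Type*} [CStarAlgebra B] {u v : B} (h : IsTorusPair α u v) :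
    NCTorus α →⋆ₐ[ℂ] B :=
  (existsUnique_lift h).exists.choose

theorem lift_U {α : ℝ} {B : Type*} [CStarAlgebra B] {u v : B} (h : IsTorusPair α u v) :
    lift h (U α) = u := (existsUnique_lift h).exists.choose_spec.1

theorem lift_V {α : ℝ} {B : Type*} [CStarAlgebra B] {u v : B} (h : IsTorusPair α u v) :
    lift h (V α) = v := (existsUnique_lift h).exists.choose_spec.2

/-! ### The canonical trace -/

/-- The Hilbert space `ℓ²(ℤ × ℤ)`. -/
abbrev L2Z : Type := lp (fun _ : ℤ × ℤ => ℂ) 2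

theorem weightedShift_memℓp (σ : Equiv.Perm (ℤ × ℤ)) (c : ℤ × ℤ → Circle) (ξ : L2Z) :
    Memℓp (fun p => (c p : ℂ) * ξ (σ p)) 2 := by
  have h := lp.memℓp ξ
  rw [memℓp_gen_iff (by norm_num)] at h ⊢
  simp only [norm_mul, Circle.norm_coe, one_mul]
  exact (σ.summable_iff (f := fun p => ‖ξ p‖ ^ (2 : ℝ≥0∞).toReal)).mpr h

/-- The unitary operator `ξ ↦ (p ↦ c(p) ξ(σ p))` on `ℓ²(ℤ × ℤ)`. -/
def weightedShift (σ : Equiv.Perm (ℤ × ℤ)) (c : ℤ × ℤ → Circle) : L2Z ≃ₗᵢ[ℂ] L2Z where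
  toFun ξ := ⟨fun p => (c p : ℂ) * ξ (σ p), weightedShift_memℓp σ c ξ⟩
  invFun ξ := ⟨fun p => (((c (σ.symm p))⁻¹ : Circle) : ℂ) * ξ (σ.symm p),
    weightedShift_memℓp σ.symm (fun p => (c (σ.symm p))⁻¹) ξ⟩
  map_add' ξ η := by ext p; exact mul_add _ _ _
  map_smul' a ξ := by ext p; simp [mul_left_comm]
  left_inv ξ := by ext p; simp
  right_inv ξ := by ext p; simp
  norm_map' ξ := by
    rw [lp.norm_eq_tsum_rpow (by norm_num), lp.norm_eq_tsum_rpow (by norm_num)]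
    congr 1
    have := σ.tsum_eq (fun p => ‖ξ p‖ ^ (2 : ℝ≥0∞).toReal)
    rw [← this]
    refine tsum_congr fun p => ?_
    simp [Circle.norm_coe]

theorem weightedShift_apply (σ : Equiv.Perm (ℤ × ℤ)) (c : ℤ × ℤ → Circle) (ξ : L2Z) (p : ℤ × ℤ) :
    weightedShift σ c ξ p = (c p : ℂ) * ξ (σ p) := rfl

/-- `(u ξ)(k, l) = ξ(k - 1, l)`, that is `u δ_{k,l} = δ_{k+1,l}`. -/
def regU : L2Z ≃ₗᵢ[ℂ] L2Z :=
  weightedShift ((Equiv.subRight (1 : ℤ)).prodCongr (Equiv.refl ℤ)) 1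

/-- `(v ξ)(k, l) = e^{-2πiαk} ξ(k, l - 1)`, that is `v δ_{k,l} = e^{-2πiαk} δ_{k,l+1}`. -/
def regV (α : ℝ) : L2Z ≃ₗᵢ[ℂ] L2Z :=
  weightedShift ((Equiv.refl ℤ).prodCongr (Equiv.subRight (1 : ℤ)))
    fun p => Circle.exp (-(2 * Real.pi * α * p.1))

theorem pair_reg (α : ℝ) : IsTorusPair α (regU : L2Z →L[ℂ] L2Z) (regV α : L2Z →L[ℂ] L2Z) where
  u_mem := (Unitary.linearIsometryEquiv.symm regU).2
  v_mem := (Unitary.linearIsometryEquiv.symm (regV α)).2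
  comm := by
    ext ξ p
    change regU (regV α ξ) p = Complex.exp _ * regV α (regU ξ) p
    simp only [regU, regV, weightedShift_apply]
    simp only [Circle.coe_exp, Pi.one_apply, Circle.coe_one, one_mul, ← mul_assoc,
      ← Complex.exp_add]
    change Complex.exp _ * ξ (p.1 - 1, p.2 - 1) = Complex.exp _ * ξ (p.1 - 1, p.2 - 1)
    congr 2
    simp
    ring

/-- The regular representation of the noncommutative torus on `ℓ²(ℤ × ℤ)`. -/
def regRep (α : ℝ) : NCTorus α →⋆ₐ[ℂ] (L2Z →L[ℂ] L2Z) := lift (pair_reg α)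

/-- The vector `δ_{0,0}` of `ℓ²(ℤ × ℤ)`. -/
def vac : L2Z := lp.single 2 (0, 0) (1 : ℂ)

/-- The canonical trace `τ(x) = ⟨δ_{0,0}, x δ_{0,0}⟩` of the noncommutative torus; by
`trace_monomial` it satisfies `τ(U^m V^n) = δ_{m,0} δ_{n,0}`. -/
def trace (α : ℝ) : NCTorus α →L[ℂ] ℂ where
  toFun x := ⟪vac, regRep α x vac⟫_ℂ
  map_add' x y := by simp
  map_smul' c x := by simp
  cont := by
    have := continuous_starAlgHom (regRep α)
    fun_prop

/-- The first generator as a unitary. -/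
def unitaryU (α : ℝ) : unitary (NCTorus α) := ⟨U α, (pair_UV α).u_mem⟩

/-- The second generator as a unitary. -/
def unitaryV (α : ℝ) : unitary (NCTorus α) := ⟨V α, (pair_UV α).v_mem⟩

theorem regU_zpow (m : ℤ) (ξ : L2Z) (p : ℤ × ℤ) : (regU ^ m) ξ p = ξ (p.1 - m, p.2) := by
  induction m generalizing ξ with
  | zero => simp
  | succ m ih =>
    rw [zpow_add_one]
    change (regU ^ (m : ℤ)) (regU ξ) p = _
    rw [ih]
    change ((1 : Circle) : ℂ) * ξ (p.1 - m - 1, p.2) = _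
    simp [sub_sub]
  | pred m ih =>
    obtain ⟨η, rfl⟩ := regU.surjective ξ
    rw [zpow_sub_one]
    change (regU ^ (-m : ℤ)) (regU.symm (regU η)) p = _
    rw [LinearIsometryEquiv.symm_apply_apply, ih]
    change _ = ((1 : Circle) : ℂ) * η (p.1 - (-m - 1) - 1, p.2)
    rw [Circle.coe_one, one_mul, show p.1 - (-(m : ℤ) - 1) - 1 = p.1 - -m by ring]

theorem regV_zpow (α : ℝ) (n : ℤ) (ξ : L2Z) (p : ℤ × ℤ) :
    (regV α ^ n) ξ p = (Circle.exp (-(2 * Real.pi * α * p.1)) ^ n : Circle) * ξ (p.1, p.2 - n) := by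
  induction n generalizing ξ with
  | zero => simp
  | succ m ih =>
    rw [zpow_add_one]
    change (regV α ^ (m : ℤ)) (regV α ξ) p = _
    rw [ih]
    change _ * ((Circle.exp (-(2 * Real.pi * α * p.1)) : ℂ) * ξ (p.1, p.2 - m - 1)) = _
    rw [zpow_add_one, sub_sub, Circle.coe_mul, ← mul_assoc]
  | pred m ih =>
    obtain ⟨η, rfl⟩ := (regV α).surjective ξ
    rw [zpow_sub_one]
    change (regV α ^ (-m : ℤ)) ((regV α).symm (regV α η)) p = _
    rw [LinearIsometryEquiv.symm_apply_apply, ih]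
    change _ = _ * ((Circle.exp (-(2 * Real.pi * α * p.1)) : ℂ) * η (p.1, p.2 - (-m - 1) - 1))
    rw [← mul_assoc, ← Circle.coe_mul, zpow_sub_one, inv_mul_cancel_right,
      show p.2 - (-(m : ℤ) - 1) - 1 = p.2 - -m by ring]

theorem regRep_monomial (α : ℝ) (m n : ℤ) (ξ : L2Z) :
    regRep α ((unitaryU α ^ m * unitaryV α ^ n : unitary (NCTorus α)) : NCTorus α) ξ
      = (regU ^ m) ((regV α ^ n) ξ) := by
  have hU : Unitary.map (StarMonoidHom.ofClass (regRep α)) (unitaryU α) = Unitary.linearIsometryEquiv.symm regU :=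
    Subtype.ext (lift_U (pair_reg α))
  have hV : Unitary.map (StarMonoidHom.ofClass (regRep α)) (unitaryV α) = Unitary.linearIsometryEquiv.symm (regV α) :=
    Subtype.ext (lift_V (pair_reg α))
  have h : Unitary.map (StarMonoidHom.ofClass (regRep α)) (unitaryU α ^ m * unitaryV α ^ n)
      = Unitary.linearIsometryEquiv.symm (regU ^ m * regV α ^ n) := by
    rw [map_mul, map_zpow, map_zpow, hU, hV, map_mul, map_zpow, map_zpow]
  exact DFunLike.congr_fun (congrArg Subtype.val h) ξ

theorem trace_monomial (α : ℝ) (m n : ℤ) :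
    trace α ((unitaryU α ^ m * unitaryV α ^ n : unitary (NCTorus α)) : NCTorus α)
      = if m = 0 ∧ n = 0 then 1 else 0 := by
  change ⟪vac, regRep α _ vac⟫_ℂ = _
  rw [regRep_monomial, vac, lp.inner_single_left, regU_zpow, regV_zpow]
  rcases eq_or_ne m 0 with rfl | hm <;> rcases eq_or_ne n 0 with rfl | hn <;>
    simp [lp.single_apply, *]

/-! ### The Anzai skew-product -/

/-- The rotation `R_β z = e^{2πiβ} z` of the unit circle. -/
def rotation (β : ℝ) (z : Circle) : Circle := Circle.exp (2 * Real.pi * β) * z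

/-- Extension by zero of a circle-valued function on the circle to the complex plane. -/
def extendCircle (f : C(Circle, Circle)) : ℂ → ℂ :=
  Function.extend ((↑) : Circle → ℂ) (fun z => (f z : ℂ)) 0

theorem extendCircle_coe (f : C(Circle, Circle)) (z : Circle) : extendCircle f z = f z :=
  Circle.coe_injective.extend_apply _ _ _

theorem extendCircle_continuousOn (f : C(Circle, Circle)) :
    ContinuousOn (extendCircle f) (unitary ℂ : Set ℂ) := by
  rw [continuousOn_iff_continuous_domRestrict]
  have h : ∀ z : (unitary ℂ : Set ℂ), ‖(z : ℂ)‖ = 1 := fun z => CStarRing.norm_of_mem_unitary z.2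
  have hc : Continuous fun z : (unitary ℂ : Set ℂ) =>
      (f ⟨z, mem_sphere_zero_iff_norm.mpr (h z)⟩ : ℂ) := by
    refine continuous_induced_dom.comp (f.continuous.comp ?_)
    exact Continuous.subtype_mk continuous_subtype_val _
  convert hc using 2 with z
  exact extendCircle_coe f ⟨z, _⟩

/-- The unitary `f(u)` obtained from a unitary `u` of a C⋆-algebra and a continuous
`f : 𝕋 → 𝕋` by the continuous functional calculus. -/
def circleCalc {B : Type*} [CStarAlgebra B] (f : C(Circle, Circle)) (u : B) : B :=
  cfc (extendCircle f) u

theorem circleCalc_mem {B : Type*} [CStarAlgebra B] (f : C(Circle, Circle)) {u : B}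
    (hu : u ∈ unitary B) : circleCalc f u ∈ unitary B := by
  have hs := spectrum_subset_unitary_of_mem_unitary hu
  have hn := isStarNormal_of_mem_unitary hu
  rw [circleCalc, cfc_unitary_iff _ _ hn ((extendCircle_continuousOn f).mono hs)]
  intro z hz
  have h : ‖z‖ = 1 := CStarRing.norm_of_mem_unitary (hs hz)
  have := extendCircle_coe f ⟨z, mem_sphere_zero_iff_norm.mpr h⟩
  change extendCircle f z = _ at this
  rw [this]
  rw [Complex.star_def, ← Complex.normSq_eq_conj_mul_self, Circle.normSq_coe, Complex.ofReal_one]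

theorem circleCalc_commute {B : Type*} [CStarAlgebra B] (f : C(Circle, Circle)) (u : B) :
    Commute u (circleCalc f u) := by
  by_cases hu : IsStarNormal u
  · have := cfc_commute_cfc (fun z : ℂ => z) (extendCircle f) u
    rwa [cfc_id' ℂ u] at this
  · rw [circleCalc, cfc_apply_of_not_predicate u hu]
    exact Commute.zero_right u

theorem pair_anzai (α θ : ℝ) (f : C(Circle, Circle)) :
    IsTorusPair α ((Circle.exp θ : ℂ) • U α) (circleCalc f (U α) * V α) where
  u_mem := by
    have hU := Unitary.mem_iff.mp (pair_UV α).u_mem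
    have hz : conj (Circle.exp θ : ℂ) * Circle.exp θ = 1 := by
      rw [← Complex.normSq_eq_conj_mul_self, Circle.normSq_coe, Complex.ofReal_one]
    rw [Unitary.mem_iff, star_smul, smul_mul_smul_comm, smul_mul_smul_comm, hU.1, hU.2,
      Complex.star_def, mul_comm (Circle.exp θ : ℂ), hz, one_smul]
    exact ⟨rfl, rfl⟩
  v_mem := mul_mem (circleCalc_mem f (pair_UV α).u_mem) (pair_UV α).v_mem
  comm := by
    have hc := (circleCalc_commute f (U α)).eq
    rw [smul_mul_assoc, ← mul_assoc, hc, mul_assoc, (pair_UV α).comm]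
    simp only [mul_smul_comm, mul_assoc]
    rw [smul_comm]

/-- The ⋆-endomorphism of `𝔸_α` with `U ↦ e^{iθ} U` and `V ↦ f(U) V`. -/
def anzaiHom (α θ : ℝ) (f : C(Circle, Circle)) : NCTorus α →⋆ₐ[ℂ] NCTorus α :=
  lift (pair_anzai α θ f)

/-- The function `z ↦ conj (f (e^{-iθ} z))`. -/
def anzaiInv (θ : ℝ) (f : C(Circle, Circle)) : C(Circle, Circle) where
  toFun z := (f (Circle.exp (-θ) * z))⁻¹

theorem anzaiHom_comp (α θ θ' : ℝ) (f f' : C(Circle, Circle)) (hθ : θ' = -θ)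
    (hf : ∀ z, f' (Circle.exp θ * z) * f z = 1) :
    (anzaiHom α θ f).comp (anzaiHom α θ' f') = StarAlgHom.id ℂ _ := by
  subst hθ
  have hU := (pair_UV α).u_mem
  have hs := spectrum_subset_unitary_of_mem_unitary hU
  have hn := isStarNormal_of_mem_unitary hU
  have hu : anzaiHom α θ f (U α) = (Circle.exp θ : ℂ) • U α := lift_U _
  have hv : anzaiHom α θ f (V α) = circleCalc f (U α) * V α := lift_V _
  have hu' : anzaiHom α (-θ) f' (U α) = (Circle.exp (-θ) : ℂ) • U α := lift_U _
  have hv' : anzaiHom α (-θ) f' (V α) = circleCalc f' (U α) * V α := lift_V _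
  have hcU : (Circle.exp θ : ℂ) • U α ∈ unitary (NCTorus α) := (pair_anzai α θ f).u_mem
  have hcn := isStarNormal_of_mem_unitary hcU
  have hmul : ∀ z ∈ spectrum ℂ (U α), (Circle.exp θ : ℂ) * z ∈ unitary ℂ := fun z hz =>
    mul_mem (by
      rw [Unitary.mem_iff_star_mul_self, Complex.star_def, ← Complex.normSq_eq_conj_mul_self,
        Circle.normSq_coe, Complex.ofReal_one]) (hs hz)
  have hc1 : ContinuousOn (extendCircle f') (((Circle.exp θ : ℂ) * ·) '' spectrum ℂ (U α)) :=
    (extendCircle_continuousOn f').mono (by rintro _ ⟨z, hz, rfl⟩; exact hmul z hz)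
  have hc2 : ContinuousOn (fun z => extendCircle f' ((Circle.exp θ : ℂ) * z))
      (spectrum ℂ (U α)) :=
    hc1.comp (by fun_prop) fun z hz => ⟨z, hz, rfl⟩
  have hc3 := (extendCircle_continuousOn f).mono hs
  refine hom_ext ?_ ?_
  · change anzaiHom α θ f (anzaiHom α (-θ) f' (U α)) = U α
    rw [hu', map_smul, hu, smul_smul, ← Circle.coe_mul, ← Circle.exp_add]
    simp
  · have hmap : anzaiHom α θ f (circleCalc f' (U α)) = circleCalc f' ((Circle.exp θ : ℂ) • U α) := by
      rw [circleCalc, StarAlgHom.map_cfc (anzaiHom α θ f) (extendCircle f') (U α)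
        ((extendCircle_continuousOn f').mono hs) (continuous_starAlgHom _) hn
        (by rw [hu]; exact hcn), hu, circleCalc]
    have hone : circleCalc f' ((Circle.exp θ : ℂ) • U α) * circleCalc f (U α) = 1 := by
      rw [circleCalc, circleCalc, ← cfc_comp_const_mul _ _ _ hc1 hn, ← cfc_mul _ _ _ hc2 hc3,
        ← cfc_one ℂ (U α) hn]
      refine cfc_congr fun z hz => ?_
      have h : ‖z‖ = 1 := CStarRing.norm_of_mem_unitary (hs hz)
      obtain ⟨w, rfl⟩ : ∃ w : Circle, (w : ℂ) = z := ⟨⟨z, mem_sphere_zero_iff_norm.mpr h⟩, rfl⟩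
      change extendCircle f' ((Circle.exp θ : ℂ) * w) * extendCircle f w = 1
      rw [← Circle.coe_mul, extendCircle_coe, extendCircle_coe, ← Circle.coe_mul, hf,
        Circle.coe_one]
    change anzaiHom α θ f (anzaiHom α (-θ) f' (V α)) = V α
    rw [hv', map_mul, hmap, hv, ← mul_assoc, hone, one_mul]

/-- The Anzai skew-product `Φ_{θ,f}`: the ⋆-automorphism of `𝔸_α` with `U ↦ e^{iθ} U` and
`V ↦ f(U) V`. -/
def anzai (α θ : ℝ) (f : C(Circle, Circle)) : NCTorus α ≃⋆ₐ[ℂ] NCTorus α :=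
  StarAlgEquiv.ofStarAlgHom (anzaiHom α θ f) (anzaiHom α (-θ) (anzaiInv θ f))
    (anzaiHom_comp α (-θ) θ (anzaiInv θ f) f (by simp) fun z => by simp [anzaiInv])
    (anzaiHom_comp α θ (-θ) f (anzaiInv θ f) rfl fun z => by simp [anzaiInv])

theorem anzai_U (α θ : ℝ) (f : C(Circle, Circle)) :
    anzai α θ f (U α) = (Circle.exp θ : ℂ) • U α := lift_U _

theorem anzai_V (α θ : ℝ) (f : C(Circle, Circle)) :
    anzai α θ f (V α) = circleCalc f (U α) * V α := lift_V _

/-- The twisted cocycle product `f_n`. -/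
def cocycle (α : ℝ) (f : C(Circle, Circle)) (n : ℤ) (z : Circle) : ℂ :=
  if 0 ≤ n then ∏ l ∈ Finset.range n.natAbs, (f (rotation (-(l * α)) z) : ℂ)
  else ∏ l ∈ Finset.Icc 1 n.natAbs, conj (f (rotation (l * α) z) : ℂ)

end NCTorus

/-! ### Ergodic states of C⋆-dynamical systems -/

/-- A state of a unital C⋆-algebra. -/
def IsState {A : Type*} [CStarAlgebra A] (φ : A →L[ℂ] ℂ) : Prop :=
  φ 1 = 1 ∧ ∀ a : A, 0 ≤ φ (star a * a)

/-- The convex set of states invariant under a ⋆-automorphism. -/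
def invariantStates {A : Type*} [CStarAlgebra A] (γ : A ≃⋆ₐ[ℂ] A) : Set (A →L[ℂ] ℂ) :=
  {φ | IsState φ ∧ ∀ a : A, φ (γ a) = φ a}

/-- The C⋆-dynamical system `(A, γ, φ)` is ergodic: `φ` is an extreme point of the convex set of
`γ`-invariant states. -/
def IsErgodicSystem {A : Type*} [CStarAlgebra A] (γ : A ≃⋆ₐ[ℂ] A) (φ : A →L[ℂ] ℂ) : Prop :=
  φ ∈ Set.extremePoints ℝ (invariantStates γ)

/-! ### The circle as a measure space -/

instance : MeasurableSpace Circle := borel Circle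

instance : BorelSpace Circle := ⟨rfl⟩

/-- The normalised Lebesgue (Haar) probability measure `dz/(2πiz)` on the unit circle, the image of
`dt` on `ℝ/ℤ` under `t ↦ e^{2πit}`. -/
def circleMeasure : MeasureTheory.Measure Circle :=
  MeasureTheory.Measure.map (AddCircle.toCircle : UnitAddCircle → Circle) AddCircle.haarAddCircle

instance : MeasureTheory.IsProbabilityMeasure circleMeasure :=
  MeasureTheory.Measure.isProbabilityMeasure_map AddCircle.continuous_toCircle.aemeasurable

end

/-!
In the GNS representation of `τ` on `ℓ²(ℤ × ℤ)`, row `n` is a copy `W_n L²(𝕋)` of `L²(𝕋)`, and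
`h(U)Vⁿ` sends the cyclic vector `Ω` to `W_n h`. Since `Φ(h(U)Vⁿ) = ((h ∘ R) f_n)(U)Vⁿ`, the
automorphism acts on row `n` as the isometry `T_n g = (g ∘ R) f_n`, and for `g ∈ L²(𝕋)` the
functional `⟨W_n g, · Ω⟩` is `Φ`-invariant iff `T_n g = g`, which is the cohomological equation.

A state dominated by a multiple of `τ` has the form `⟨η, · Ω⟩`; if it is invariant, each row of `η`
is fixed by the corresponding `T_n`. Without nonzero solutions the rows `n ≠ 0` vanish, and row `0`
is constant because `R` is ergodic, so the state is `τ`. Conversely, a solution `g` for some `n ≠ 0`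
has constant modulus, hence `ξ = W_n g` implements a multiple of `τ`, and up to normalisation
`Ω ± ξ` implement invariant states with average `τ`. Extremality kills the cross terms, in
particular `⟨W_n g, · Ω⟩`, which forces `g = 0`.
-/

open MeasureTheory

noncomputable section

section Hilbert

variable {𝕜 H : Type*} [RCLike 𝕜] [NormedAddCommGroup H] [InnerProductSpace 𝕜 H]

theorem exists_inner_eq_of_norm_le [CompleteSpace H] {E : Type*} [AddCommGroup E] [Module 𝕜 E]
    (e : E →ₗ[𝕜] H) (ψ : E →ₗ[𝕜] 𝕜) {C : ℝ} (hψ : ∀ x, ‖ψ x‖ ≤ C * ‖e x‖) :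
    ∃ η : H, ∀ x, ⟪η, e x⟫_𝕜 = ψ x := by
  have hdense : DenseRange e.rangeRestrict := e.surjective_rangeRestrict.denseRange
  obtain ⟨Ψ, hΨ, -⟩ := exists_extension_norm_eq _ (ψ.extendOfNorm e.rangeRestrict)
  refine ⟨(InnerProductSpace.toDual 𝕜 H).symm Ψ, fun x => ?_⟩
  rw [InnerProductSpace.toDual_symm_apply]
  exact (hΨ (e.rangeRestrict x)).trans (LinearMap.extendOfNorm_eq hdense ⟨C, hψ⟩ x)

theorem apply_eq_self_of_inner_apply_eq {T : H →ₗᵢ[𝕜] H} {g : H}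
    (hg : ∀ k, ⟪g, T k⟫_𝕜 = ⟪g, k⟫_𝕜) : T g = g := by
  have h : RCLike.re ⟪T g, g⟫_𝕜 = ‖g‖ ^ 2 := by
    rw [inner_re_symm, hg, inner_self_eq_norm_sq]
  rw [← sub_eq_zero, ← norm_eq_zero, ← sq_eq_zero_iff, @norm_sub_sq 𝕜, T.norm_map, h]
  ring

theorem inner_apply_eq_iff_apply_eq_self (T : H →ₗᵢ[𝕜] H) {D : Set H} (hD : Dense D) {g : H} :
    (∀ k ∈ D, ⟪g, T k⟫_𝕜 = ⟪g, k⟫_𝕜) ↔ T g = g := by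
  refine ⟨fun h => apply_eq_self_of_inner_apply_eq fun k => ?_, fun h k _ => ?_⟩
  · refine congrFun (Continuous.ext_on hD ?_ ?_ h) k
    · exact continuous_const.inner T.continuous
    · exact continuous_const.inner continuous_id
  · rw [← T.inner_map_map g k, h]

end Hilbert

section States

variable {A : Type*} [CStarAlgebra A]

theorem IsState.norm_sq_le {φ : A →L[ℂ] ℂ} (hφ : IsState φ) (y : A) :
    ‖φ y‖ ^ 2 ≤ (φ (star y * y)).re := by
  let _ := CStarAlgebra.spectralOrder A
  let _ := CStarAlgebra.spectralOrderedRing A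
  let ψ : A →ₚ[ℂ] ℂ := .mk₀ φ.toLinearMap fun a ha => by
    obtain ⟨b, rfl⟩ := CStarAlgebra.nonneg_iff_eq_star_mul_self.mp ha
    exact hφ.2 b
  have hψ (a b : A) : ⟪ψ.toPreGNS a, ψ.toPreGNS b⟫_ℂ = φ (star a * b) := rfl
  have hinner : ⟪ψ.toPreGNS 1, ψ.toPreGNS y⟫_ℂ = φ y := by rw [hψ, star_one, one_mul]
  have hone : ‖ψ.toPreGNS 1‖ ^ 2 = 1 := by
    rw [← @inner_self_eq_norm_sq ℂ, hψ, star_one, one_mul, hφ.1, RCLike.one_re]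
  calc ‖φ y‖ ^ 2 ≤ (‖ψ.toPreGNS 1‖ * ‖ψ.toPreGNS y‖) ^ 2 := by
        rw [← hinner]
        gcongr
        exact norm_inner_le_norm _ _
    _ = (φ (star y * y)).re := by
        rw [mul_pow, hone, one_mul, ← @inner_self_eq_norm_sq ℂ, hψ]
        rfl

theorem isErgodicSystem_of_forall_dominated {γ : A ≃⋆ₐ[ℂ] A} {τ : A →L[ℂ] ℂ}
    (hτ : τ ∈ invariantStates γ)
    (h : ∀ φ ∈ invariantStates γ,
      (∃ C : ℝ, ∀ y, (φ (star y * y)).re ≤ C * (τ (star y * y)).re) → φ = τ) :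
    IsErgodicSystem γ τ := by
  refine ⟨hτ, fun φ hφ ψ hψ ⟨a, b, ha, hb, _, hab⟩ => h φ hφ ⟨a⁻¹, fun y => ?_⟩⟩
  have hsplit : (τ (star y * y)).re = a * (φ (star y * y)).re + b * (ψ (star y * y)).re := by
    rw [← hab]
    simp
  have hψy : 0 ≤ b * (ψ (star y * y)).re :=
    mul_nonneg hb.le (Complex.nonneg_iff.mp (hψ.1.2 y)).1
  rw [le_inv_mul_iff₀ ha]
  linarith

end States

section MatrixCoefficient

variable {A H : Type*} [CStarAlgebra A] [NormedAddCommGroup H] [InnerProductSpace ℂ H]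
  [CompleteSpace H]

/-- The matrix coefficient `x ↦ ⟪ξ, π(x) η⟫` of a representation `π`; it is antilinear in `ξ` and
linear in `η`. -/
def matrixCoefficient (π : A →⋆ₐ[ℂ] (H →L[ℂ] H)) (ξ η : H) : A →L[ℂ] ℂ :=
  innerSL ℂ ξ ∘L ContinuousLinearMap.apply ℂ H η ∘L
    ⟨π.toAlgHom.toLinearMap, NCTorus.continuous_starAlgHom π⟩

variable (π : A →⋆ₐ[ℂ] (H →L[ℂ] H))

theorem matrixCoefficient_apply (ξ η : H) (x : A) : matrixCoefficient π ξ η x = ⟪ξ, π x η⟫_ℂ :=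
  rfl

theorem matrixCoefficient_star_mul (ξ η : H) (x y : A) :
    matrixCoefficient π ξ η (star x * y) = ⟪π x ξ, π y η⟫_ℂ := by
  rw [matrixCoefficient_apply, map_mul, map_star, ContinuousLinearMap.star_eq_adjoint,
    ContinuousLinearMap.mul_def, ContinuousLinearMap.comp_apply,
    ContinuousLinearMap.adjoint_inner_right]

theorem matrixCoefficient_star (ξ η : H) (x : A) :
    matrixCoefficient π ξ η (star x) = conj (matrixCoefficient π η ξ x) := by
  simpa [matrixCoefficient_apply] using matrixCoefficient_star_mul π ξ η x 1

theorem matrixCoefficient_self_star_mul_self (ξ : H) (x : A) :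
    matrixCoefficient π ξ ξ (star x * x) = (‖π x ξ‖ : ℂ) ^ 2 := by
  rw [matrixCoefficient_star_mul]
  exact inner_self_eq_norm_sq_to_K _

theorem matrixCoefficient_neg_left (ξ η : H) :
    matrixCoefficient π (-ξ) η = -matrixCoefficient π ξ η := by
  ext x
  exact inner_neg_left _ _

theorem matrixCoefficient_neg_right (ξ η : H) :
    matrixCoefficient π ξ (-η) = -matrixCoefficient π ξ η := by
  ext x
  simp only [matrixCoefficient_apply, neg_apply, map_neg, inner_neg_right]

theorem matrixCoefficient_add_add (ξ η : H) :
    matrixCoefficient π (ξ + η) (ξ + η) = matrixCoefficient π ξ ξ + matrixCoefficient π η η +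
      (matrixCoefficient π ξ η + matrixCoefficient π η ξ) := by
  ext x
  simp only [matrixCoefficient_apply, add_apply, map_add, inner_add_left,
    inner_add_right]
  ring

theorem IsState.exists_eq_matrixCoefficient {φ : A →L[ℂ] ℂ} (hφ : IsState φ) {Ω : H} {C : ℝ}
    (hC : ∀ y, (φ (star y * y)).re ≤ C * ‖π y Ω‖ ^ 2) :
    ∃ η : H, φ = matrixCoefficient π η Ω := by
  have hbound (y : A) : ‖φ y‖ ≤ √C * ‖π y Ω‖ := by
    rw [← Real.sqrt_sq (norm_nonneg (π y Ω)), ← Real.sqrt_mul' C (sq_nonneg _)]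
    exact Real.le_sqrt_of_sq_le ((hφ.norm_sq_le y).trans (hC y))
  obtain ⟨η, hη⟩ := exists_inner_eq_of_norm_le
    ((LinearMap.applyₗ Ω ∘ₗ ContinuousLinearMap.coeLM ℂ) ∘ₗ π.toAlgHom.toLinearMap)
    φ.toLinearMap hbound
  exact ⟨η, ContinuousLinearMap.ext fun y => (hη y).symm⟩

variable {π} {γ : A ≃⋆ₐ[ℂ] A} {Ω ξ : H}

theorem matrixCoefficient_add_cross_mem_invariantStates
    (hΩ : matrixCoefficient π Ω Ω ∈ invariantStates γ) (horth : ⟪Ω, ξ⟫_ℂ = 0)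
    (hξ : matrixCoefficient π ξ ξ = (‖ξ‖ : ℂ) ^ 2 • matrixCoefficient π Ω Ω)
    (hinv : ∀ a, matrixCoefficient π ξ Ω (γ a) = matrixCoefficient π ξ Ω a) :
    matrixCoefficient π Ω Ω + ((1 + ‖ξ‖ ^ 2 : ℝ) : ℂ)⁻¹ •
      (matrixCoefficient π Ω ξ + matrixCoefficient π ξ Ω) ∈ invariantStates γ := by
  have hN : (0 : ℝ) < 1 + ‖ξ‖ ^ 2 := by positivity
  have hN' : (1 : ℂ) + (‖ξ‖ : ℂ) ^ 2 ≠ 0 := by exact_mod_cast hN.ne'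
  have hvector : matrixCoefficient π Ω Ω + ((1 + ‖ξ‖ ^ 2 : ℝ) : ℂ)⁻¹ •
      (matrixCoefficient π Ω ξ + matrixCoefficient π ξ Ω) =
      ((1 + ‖ξ‖ ^ 2 : ℝ) : ℂ)⁻¹ • matrixCoefficient π (Ω + ξ) (Ω + ξ) := by
    rw [matrixCoefficient_add_add, hξ]
    push_cast
    match_scalars <;> field_simp
  have hinv' (a : A) : matrixCoefficient π Ω ξ (γ a) = matrixCoefficient π Ω ξ a := by
    rw [← star_star (γ a), matrixCoefficient_star, ← map_star, hinv, ← matrixCoefficient_star,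
      star_star]
  refine ⟨⟨?_, fun a => ?_⟩, fun a => ?_⟩
  · have horth' : ⟪ξ, Ω⟫_ℂ = 0 := inner_eq_zero_symm.mp horth
    have hone := hΩ.1.1
    simp only [matrixCoefficient_apply, map_one, one_apply_eq_self, add_apply,
      smul_apply] at hone ⊢
    rw [hone, horth, horth', add_zero, smul_zero, add_zero]
  · rw [hvector, smul_apply, matrixCoefficient_self_star_mul_self, smul_eq_mul]
    exact_mod_cast mul_nonneg (inv_nonneg.mpr hN.le) (sq_nonneg _)
  · simp only [add_apply, smul_apply, hΩ.2, hinv, hinv']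

theorem IsErgodicSystem.matrixCoefficient_cross_eq_zero
    (h : IsErgodicSystem γ (matrixCoefficient π Ω Ω)) (horth : ⟪Ω, ξ⟫_ℂ = 0)
    (hξ : matrixCoefficient π ξ ξ = (‖ξ‖ : ℂ) ^ 2 • matrixCoefficient π Ω Ω)
    (hinv : ∀ a, matrixCoefficient π ξ Ω (γ a) = matrixCoefficient π ξ Ω a) :
    matrixCoefficient π Ω ξ + matrixCoefficient π ξ Ω = 0 := by
  have hplus := matrixCoefficient_add_cross_mem_invariantStates h.1 horth hξ hinv
  have hminus := matrixCoefficient_add_cross_mem_invariantStates (ξ := -ξ) h.1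
    (by rw [inner_neg_right, horth, neg_zero])
    (by rw [matrixCoefficient_neg_left, matrixCoefficient_neg_right, neg_neg, norm_neg, hξ])
    (fun a => by simpa only [matrixCoefficient_neg_left, neg_apply, neg_inj] using hinv a)
  rw [norm_neg, matrixCoefficient_neg_left, matrixCoefficient_neg_right, ← neg_add, smul_neg]
    at hminus
  set cross := matrixCoefficient π Ω ξ + matrixCoefficient π ξ Ω
  have hN : ((1 + ‖ξ‖ ^ 2 : ℝ) : ℂ)⁻¹ ≠ 0 := by
    have : (0 : ℝ) < 1 + ‖ξ‖ ^ 2 := by positivity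
    exact inv_ne_zero (Complex.ofReal_ne_zero.mpr this.ne')
  have hmid := h.2 hplus hminus ⟨1 / 2, 1 / 2, by norm_num, by norm_num, by norm_num, by module⟩
  exact (smul_eq_zero.mp (add_eq_left.mp hmid)).resolve_left hN

end MatrixCoefficient

theorem eq_zpow_of_add_one {M : Type*} [Monoid M] {w : ℤ → M} {a : Mˣ} (h0 : w 0 = 1)
    (h : ∀ n, w (n + 1) = w n * a) (n : ℤ) : w n = (a ^ n : Mˣ) := by
  induction n with
  | zero => rw [h0, zpow_zero, Units.val_one]
  | succ n ih => rw [h, ih, zpow_add_one, Units.val_mul]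
  | pred n ih => rw [zpow_sub_one, Units.val_mul, ← ih, Units.eq_mul_inv_iff_mul_eq, ← h,
      sub_add_cancel]

section WeightedComposition

variable {𝕜 X : Type*} [RCLike 𝕜] [MeasurableSpace X] {μ : Measure X} {p : ℝ≥0∞} {R : X → X}
  {F : X → 𝕜}

theorem memLp_weightedComposition (hR : MeasurePreserving R μ μ)
    (hF : AEStronglyMeasurable F μ) (hF1 : ∀ x, ‖F x‖ = 1) (g : Lp 𝕜 p μ) :
    MemLp (fun x => g (R x) * F x) p μ := by
  have hgR := (Lp.memLp g).comp_measurePreserving hR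
  refine hgR.of_le (hgR.1.mul hF) (.of_forall fun x => ?_)
  rw [norm_mul, hF1, mul_one, Function.comp_apply]

/-- The weighted composition operator `g ↦ (g ∘ R) F` on `Lᵖ`, where `R` preserves the measure and
`F` is unimodular. -/
def weightedComposition [Fact (1 ≤ p)] (hR : MeasurePreserving R μ μ)
    (hF : AEStronglyMeasurable F μ) (hF1 : ∀ x, ‖F x‖ = 1) : Lp 𝕜 p μ →ₗᵢ[𝕜] Lp 𝕜 p μ where
  toFun g := (memLp_weightedComposition hR hF hF1 g).toLp
  map_add' g h := by
    rw [← MemLp.toLp_add]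
    refine MemLp.toLp_congr _ _ ?_
    filter_upwards [hR.quasiMeasurePreserving.ae (Lp.coeFn_add g h)] with x hx
    rw [hx, Pi.add_apply, Pi.add_apply, add_mul]
  map_smul' c g := by
    rw [RingHom.id_apply, ← MemLp.toLp_const_smul]
    refine MemLp.toLp_congr _ _ ?_
    filter_upwards [hR.quasiMeasurePreserving.ae (Lp.coeFn_smul c g)] with x hx
    rw [hx, Pi.smul_apply, Pi.smul_apply, smul_mul_assoc]
  norm_map' g := by
    rw [LinearMap.coe_mk, AddHom.coe_mk, Lp.norm_toLp, Lp.norm_def,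
      ← eLpNorm_comp_measurePreserving (Lp.aestronglyMeasurable g) hR]
    refine congrArg ENNReal.toReal (eLpNorm_congr_norm_ae (.of_forall fun x => ?_))
    rw [norm_mul, hF1, mul_one, Function.comp_apply]

variable [Fact (1 ≤ p)] (hR : MeasurePreserving R μ μ) (hF : AEStronglyMeasurable F μ)
  (hF1 : ∀ x, ‖F x‖ = 1)

theorem coeFn_weightedComposition (g : Lp 𝕜 p μ) :
    weightedComposition hR hF hF1 g =ᵐ[μ] fun x => g (R x) * F x :=
  MemLp.coeFn_toLp (memLp_weightedComposition hR hF hF1 g)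

theorem weightedComposition_eq_iff {g h : Lp 𝕜 p μ} :
    weightedComposition hR hF hF1 g = h ↔ ∀ᵐ x ∂μ, g (R x) * F x = h x := by
  rw [Lp.ext_iff]
  exact ⟨(coeFn_weightedComposition hR hF hF1 g).symm.trans,
    (coeFn_weightedComposition hR hF hF1 g).trans⟩

end WeightedComposition

theorem exists_norm_ae_eq_const_of_ergodic {X 𝕜 : Type*} [MeasurableSpace X] [RCLike 𝕜]
    {μ : Measure X} {R : X → X} (hR : Ergodic R μ) {F g : X → 𝕜}
    (hF1 : ∀ x, ‖F x‖ = 1) (hgm : AEStronglyMeasurable g μ)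
    (hg : ∀ᵐ x ∂μ, g (R x) * F x = g x) : ∃ c : ℝ, ∀ᵐ x ∂μ, ‖g x‖ = c := by
  refine hR.ae_eq_const_of_ae_eq_comp_ae hgm.norm ?_
  filter_upwards [hg] with x hx
  rw [Function.comp_apply, ← hx, norm_mul, hF1, mul_one]

section Circle

theorem continuous_rotation (β : ℝ) : Continuous (NCTorus.rotation β) :=
  continuous_const.mul continuous_id

theorem rotation_toCircle (β : ℝ) (x : UnitAddCircle) :
    NCTorus.rotation β x.toCircle = AddCircle.toCircle (x + (β : UnitAddCircle)) := by
  rw [AddCircle.toCircle_add, AddCircle.toCircle_apply_mk, NCTorus.rotation, mul_comm, div_one]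

theorem measurePreserving_toCircle :
    MeasurePreserving (AddCircle.toCircle : UnitAddCircle → Circle) AddCircle.haarAddCircle
      circleMeasure :=
  AddCircle.continuous_toCircle.measurable.measurePreserving _

theorem measurePreserving_rotation (β : ℝ) :
    MeasurePreserving (NCTorus.rotation β) circleMeasure circleMeasure := by
  refine measurePreserving_toCircle.of_semiconj
    (measurePreserving_add_right AddCircle.haarAddCircle (β : UnitAddCircle))
    (fun x => ?_) (continuous_rotation β).measurable
  exact (rotation_toCircle β x).symm

theorem ergodic_rotation {β : ℝ} (hβ : Irrational β) :
    Ergodic (NCTorus.rotation β) circleMeasure := by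
  have horder : addOrderOf (β : UnitAddCircle) = 0 := by
    rw [addOrderOf_eq_zero_iff, AddCircle.not_isOfFinAddOrder_iff_forall_rat_ne_div]
    simpa only [Irrational, Set.mem_range, not_exists, div_one] using hβ
  have hadd := AddCircle.ergodic_add_right.mpr horder
  rw [AddCircle.volume_eq_smul_haarAddCircle, ENNReal.ofReal_one, one_smul] at hadd
  exact measurePreserving_toCircle.ergodic_of_ergodic_semiconj hadd
    (measurePreserving_rotation β).measurable fun x => (rotation_toCircle β x).symm

/-- The coordinate function `z ↦ z`, as a unitary of `C(𝕋)`. -/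
def circleCoord : unitary C(Circle, ℂ) :=
  ⟨⟨(↑), continuous_subtype_val⟩, by
    have hconj (z : Circle) : conj (z : ℂ) * z = 1 := by
      rw [← Complex.normSq_eq_conj_mul_self, Circle.normSq_coe, Complex.ofReal_one]
    exact Unitary.mem_iff.mpr
      ⟨ContinuousMap.ext hconj, ContinuousMap.ext fun z => (mul_comm _ _).trans (hconj z)⟩⟩

/-- The character `z ↦ z ^ m` of the circle. -/
def character (m : ℤ) : C(Circle, ℂ) := (circleCoord ^ m : unitary C(Circle, ℂ))

theorem character_apply (m : ℤ) (z : Circle) : character m z = (z ^ m : Circle) := by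
  have h := map_zpow (Unitary.map (StarMonoidHom.ofClass (ContinuousMap.evalStarAlgHom ℂ ℂ z)))
    circleCoord m
  exact (congrArg Subtype.val h).trans (Unitary.coe_zpow _ m)

theorem character_toCircle (m : ℤ) (x : UnitAddCircle) :
    character m x.toCircle = fourier m x := by
  rw [character_apply, fourier_apply, AddCircle.toCircle_zsmul]

theorem map_character {A : Type*} [CStarAlgebra A] (Θ : C(Circle, ℂ) →⋆ₐ[ℂ] A) (u : unitary A)
    (hu : Θ circleCoord = u) (m : ℤ) : Θ (character m) = (u ^ m : unitary A) := by
  have hmap : Unitary.map (StarMonoidHom.ofClass Θ) circleCoord = u := Subtype.ext hu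
  rw [← hmap, ← map_zpow]
  rfl

theorem dense_span_character :
    Dense (Submodule.span ℂ (Set.range character) : Set C(Circle, ℂ)) := by
  let e : UnitAddCircle ≃ₜ Circle := AddCircle.homeomorphCircle one_ne_zero
  let P : C(UnitAddCircle, ℂ) →L[ℂ] C(Circle, ℂ) :=
    ⟨(ContinuousMap.compStarAlgHom' ℂ ℂ (e.symm : C(Circle, UnitAddCircle))).toLinearMap,
      ContinuousMap.continuous_precomp _⟩
  have hP (h : C(UnitAddCircle, ℂ)) (x : UnitAddCircle) : P h (e x) = h x :=
    congrArg h (e.symm_apply_apply x)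
  have hsurj : Function.Surjective P := fun k => ⟨k.comp (e : C(UnitAddCircle, Circle)), by
    ext z
    obtain ⟨x, rfl⟩ := e.surjective z
    exact hP _ x⟩
  have hfourier (m : ℤ) : P (fourier m) = character m := by
    ext z
    obtain ⟨x, rfl⟩ := e.surjective z
    rw [hP, AddCircle.homeomorphCircle_apply, character_toCircle]
  have hspan := hsurj.denseRange.dense_image P.continuous
    (Submodule.dense_iff_topologicalClosure_eq_top.mpr (span_fourier_closure_eq_top (T := 1)))
  rwa [← ContinuousLinearMap.coe_coe, ← Submodule.map_coe, Submodule.map_span, ← Set.range_comp,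
    show P.toLinearMap ∘ fourier = character from funext hfourier] at hspan

theorem clm_ext_character {E : Type*} [AddCommMonoid E] [Module ℂ E] [TopologicalSpace E]
    [T2Space E] {S T : C(Circle, ℂ) →L[ℂ] E} (h : ∀ m, S (character m) = T (character m)) :
    S = T :=
  ContinuousLinearMap.ext_on dense_span_character (Set.forall_mem_range.mpr h)

theorem starAlgHom_ext_circleCoord {A : Type*} [CStarAlgebra A] {Θ Ξ : C(Circle, ℂ) →⋆ₐ[ℂ] A}
    (h : Θ circleCoord = Ξ circleCoord) : Θ = Ξ := by
  have hΘ (m : ℤ) : Θ (character m) = Ξ (character m) := by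
    rw [map_character Θ (Unitary.map (StarMonoidHom.ofClass Θ) circleCoord) rfl]
    rw [map_character Ξ (Unitary.map (StarMonoidHom.ofClass Θ) circleCoord) h.symm]
  have := clm_ext_character (S := ⟨Θ.toAlgHom.toLinearMap, NCTorus.continuous_starAlgHom Θ⟩)
    (T := ⟨Ξ.toAlgHom.toLinearMap, NCTorus.continuous_starAlgHom Ξ⟩) hΘ
  exact StarAlgHom.ext fun h => DFunLike.congr_fun this h

/-- The ⋆-homomorphism `h ↦ h ∘ R_β` of `C(𝕋)`. -/
def rotate (β : ℝ) : C(Circle, ℂ) →⋆ₐ[ℂ] C(Circle, ℂ) :=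
  ContinuousMap.compStarAlgHom' ℂ ℂ ⟨NCTorus.rotation β, continuous_rotation β⟩

theorem rotate_apply (β : ℝ) (h : C(Circle, ℂ)) (z : Circle) :
    rotate β h z = h (NCTorus.rotation β z) := rfl

theorem rotation_zero (z : Circle) : NCTorus.rotation 0 z = z := by
  rw [NCTorus.rotation, mul_zero, Circle.exp_zero, one_mul]

theorem rotate_character (β : ℝ) (m : ℤ) :
    rotate β (character m) = ((Circle.exp (2 * Real.pi * β) ^ m : Circle) : ℂ) • character m := by
  ext z
  rw [rotate_apply, ContinuousMap.smul_apply, character_apply, character_apply, NCTorus.rotation,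
    mul_zpow, Circle.coe_mul, smul_eq_mul]

/-- Continuous functions on the circle, as elements of `L²(𝕋)`. -/
abbrev toL2 : C(Circle, ℂ) →L[ℂ] Lp ℂ 2 circleMeasure :=
  ContinuousMap.toLp 2 circleMeasure ℂ

theorem denseRange_toL2 : DenseRange toL2 :=
  ContinuousMap.toLp_denseRange ℂ circleMeasure ℂ ENNReal.ofNat_ne_top

theorem inner_toL2 (h k : C(Circle, ℂ)) :
    ⟪toL2 h, toL2 k⟫_ℂ = ∫ z, k z * conj (h z) ∂circleMeasure :=
  ContinuousMap.inner_toLp _ h k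

theorem orthonormal_character : Orthonormal ℂ fun m => toL2 (character m) := by
  have hfourier := orthonormal_iff_ite.mp (orthonormal_fourier (T := 1))
  refine orthonormal_iff_ite.mpr fun m n => ?_
  rw [← hfourier, inner_toL2, ContinuousMap.inner_toLp, circleMeasure,
    integral_map AddCircle.continuous_toCircle.aemeasurable]
  · simp only [character_toCircle]
  · exact Continuous.aestronglyMeasurable (by fun_prop)

/-- The Hilbert basis of characters of `L²(𝕋)`. -/
def characterBasis : HilbertBasis ℤ ℂ (Lp ℂ 2 circleMeasure) :=
  HilbertBasis.mk orthonormal_character <| by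
    have hspan := denseRange_toL2.dense_image toL2.continuous dense_span_character
    rw [← ContinuousLinearMap.coe_coe, ← Submodule.map_coe, Submodule.map_span,
      ← Set.range_comp] at hspan
    exact (Submodule.dense_iff_topologicalClosure_eq_top.mp hspan).ge

theorem characterBasis_apply (m : ℤ) : characterBasis m = toL2 (character m) := by
  rw [characterBasis, HilbertBasis.coe_mk]

end Circle

section CircleFunctionalCalculus

variable {B C : Type*} [CStarAlgebra B] [CStarAlgebra C]

theorem coe_mem_circle_of_mem_spectrum (u : unitary B) (z : spectrum ℂ (u : B)) :
    (z : ℂ) ∈ Submonoid.unitSphere ℂ :=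
  mem_sphere_zero_iff_norm.mpr
    (CStarRing.norm_of_mem_unitary (spectrum_subset_unitary_of_mem_unitary u.2 z.2))

/-- The functional calculus `h ↦ h(u)` of a unitary, on the continuous functions on the whole
circle. -/
def circleCFC (u : unitary B) : C(Circle, ℂ) →⋆ₐ[ℂ] B :=
  (cfcHom (isStarNormal_of_mem_unitary u.2)).comp
    (ContinuousMap.compStarAlgHom' ℂ ℂ ⟨fun z => ⟨z, coe_mem_circle_of_mem_spectrum u z⟩,
      continuous_subtype_val.subtype_mk _⟩)

theorem circleCFC_circleCoord (u : unitary B) : circleCFC u circleCoord = u :=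
  cfcHom_id (R := ℂ) (isStarNormal_of_mem_unitary u.2)

theorem circleCFC_character (u : unitary B) (m : ℤ) :
    circleCFC u (character m) = (u ^ m : unitary B) :=
  map_character (circleCFC u) u (circleCFC_circleCoord u) m

theorem circleCFC_coe_comp (u : unitary B) (f : C(Circle, Circle)) :
    circleCFC u (ContinuousMap.comp ⟨(↑), continuous_subtype_val⟩ f) =
      NCTorus.circleCalc f (u : B) := by
  have hs := spectrum_subset_unitary_of_mem_unitary u.2
  rw [NCTorus.circleCalc, cfc_apply _ _ (isStarNormal_of_mem_unitary u.2)
    ((NCTorus.extendCircle_continuousOn f).mono hs)]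
  refine congrArg (cfcHom (isStarNormal_of_mem_unitary u.2)) (ContinuousMap.ext fun z => ?_)
  exact (NCTorus.extendCircle_coe f ⟨z, coe_mem_circle_of_mem_spectrum u z⟩).symm

theorem map_circleCFC_eq_rotate (Ψ : B →⋆ₐ[ℂ] C) {u : unitary B} {v : unitary C} {β : ℝ}
    (h : Ψ u = (Circle.exp (2 * Real.pi * β) : ℂ) • (v : C)) (k : C(Circle, ℂ)) :
    Ψ (circleCFC u k) = circleCFC v (rotate β k) := by
  have hcoord : rotate β circleCoord = (Circle.exp (2 * Real.pi * β) : ℂ) • circleCoord := rfl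
  refine DFunLike.congr_fun (starAlgHom_ext_circleCoord (Θ := Ψ.comp (circleCFC u))
    (Ξ := (circleCFC v).comp (rotate β)) ?_) k
  rw [StarAlgHom.comp_apply, StarAlgHom.comp_apply, hcoord, map_smul, circleCFC_circleCoord,
    circleCFC_circleCoord, h]

theorem mul_circleCFC_eq_circleCFC_rotate_mul {u v : unitary B} {β : ℝ}
    (h : (u : B) * v = (Circle.exp (2 * Real.pi * β) : ℂ) • ((v : B) * u)) (k : C(Circle, ℂ)) :
    u * circleCFC v k = circleCFC v (rotate β k) * u := by
  have hconj : (u : B) * v * star (u : B) = (Circle.exp (2 * Real.pi * β) : ℂ) • (v : B) := by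
    rw [h, smul_mul_assoc, mul_assoc (v : B), Unitary.mul_star_self_of_mem u.2, mul_one]
  rw [← map_circleCFC_eq_rotate
    (Unitary.conjStarAlgAut ℂ B u : B →⋆ₐ[ℂ] B) (u := v) (v := v) hconj k]
  change _ = (u : B) * circleCFC v k * star (u : B) * u
  rw [mul_assoc, Unitary.star_mul_self_of_mem u.2, mul_one]

end CircleFunctionalCalculus

namespace NCTorus

variable {α : ℝ}

theorem unitaryV_zpow_mul_U (n : ℤ) :
    ((unitaryV α ^ n : unitary (NCTorus α)) : NCTorus α) * U α =
      (Circle.exp (2 * Real.pi * -(n * α)) : ℂ) •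
        (U α * (unitaryV α ^ n : unitary (NCTorus α))) := by
  have hUV : U α * V α = (Circle.exp (2 * Real.pi * α) : ℂ) • (V α * U α) := by
    rw [(pair_UV α).comm, Circle.coe_exp]
    push_cast
    ring_nf
  -- `Vⁿ` is the `n`-th character of `V`, so exchange the roles of `U` and `V`.
  have h := mul_circleCFC_eq_circleCFC_rotate_mul (u := unitaryU α) (v := unitaryV α) hUV
    (character n)
  rw [rotate_character, map_smul, circleCFC_character, smul_mul_assoc] at h
  refine (inv_smul_eq_iff₀ (Circle.coe_ne_zero _)).mpr h |>.symm.trans ?_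
  rw [← Circle.coe_inv, ← Circle.exp_zsmul, ← Circle.exp_neg]
  congr 4
  rw [zsmul_eq_mul]
  ring

theorem unitaryV_zpow_mul_circleCFC (n : ℤ) (h : C(Circle, ℂ)) :
    ((unitaryV α ^ n : unitary (NCTorus α)) : NCTorus α) * circleCFC (unitaryU α) h =
      circleCFC (unitaryU α) (rotate (-(n * α)) h) * (unitaryV α ^ n : unitary (NCTorus α)) :=
  mul_circleCFC_eq_circleCFC_rotate_mul (v := unitaryU α) (unitaryV_zpow_mul_U n) h

variable (α) in
/-- The `n`-th summand `h ↦ h(U) Vⁿ` of `𝔸_α` as a crossed product of `C(𝕋)` by `ℤ`. -/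
def crossedTerm (n : ℤ) : C(Circle, ℂ) →L[ℂ] NCTorus α :=
  (ContinuousLinearMap.mul ℂ (NCTorus α)).flip (unitaryV α ^ n : unitary (NCTorus α)) ∘L
    ⟨(circleCFC (unitaryU α)).toAlgHom.toLinearMap, continuous_starAlgHom _⟩

theorem crossedTerm_apply (n : ℤ) (h : C(Circle, ℂ)) :
    crossedTerm α n h = circleCFC (unitaryU α) h * (unitaryV α ^ n : unitary (NCTorus α)) :=
  rfl

theorem crossedTerm_character (m n : ℤ) :
    crossedTerm α n (character m) = (unitaryU α ^ m * unitaryV α ^ n : unitary (NCTorus α)) := by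
  rw [crossedTerm_apply, circleCFC_character, Submonoid.coe_mul]

theorem crossedTerm_zero_one : crossedTerm α 0 1 = 1 := by
  rw [crossedTerm_apply, map_one, one_mul, zpow_zero, OneMemClass.coe_one]

theorem crossedTerm_mul_crossedTerm (m n : ℤ) (h k : C(Circle, ℂ)) :
    crossedTerm α m h * crossedTerm α n k =
      crossedTerm α (m + n) (h * rotate (-(m * α)) k) := by
  simp only [crossedTerm_apply]
  rw [mul_assoc, ← mul_assoc (Subtype.val (unitaryV α ^ m)), unitaryV_zpow_mul_circleCFC, zpow_add,
    Submonoid.coe_mul, map_mul]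
  simp only [mul_assoc]

variable (α) in
theorem dense_adjoin_generators :
    Dense (StarAlgebra.adjoin ℂ {U α, V α} : Set (NCTorus α)) := by
  have hmap : Subtype.val '' (StarAlgebra.adjoin ℂ {U α, V α} : Set (NCTorus α)) =
      (StarAlgebra.adjoin ℂ {ambientU α, ambientV α} : Set (Ambient α)) := by
    have h := StarAlgHom.map_adjoin (torusSubalgebra α).subtype {U α, V α}
    have himage : (torusSubalgebra α).subtype '' {U α, V α} = {ambientU α, ambientV α} :=
      Set.image_pair _ _ _
    exact congrArg SetLike.coe (h.trans (congrArg _ himage))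
  intro x
  refine closure_subtype.mpr ?_
  rw [hmap]
  exact x.2

variable (α) in
/-- The multiplicative submonoid of the products `h(U) Vⁿ`. -/
def crossedTerms : Submonoid (NCTorus α) where
  carrier := {x | ∃ n h, crossedTerm α n h = x}
  one_mem' := ⟨0, 1, crossedTerm_zero_one⟩
  mul_mem' := by
    rintro _ _ ⟨m, h, rfl⟩ ⟨n, k, rfl⟩
    exact ⟨m + n, _, (crossedTerm_mul_crossedTerm m n h k).symm⟩

variable (α) in
theorem dense_span_crossedTerms :
    Dense (Submodule.span ℂ (crossedTerms α : Set (NCTorus α)) : Set (NCTorus α)) := by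
  have hmem (m n : ℤ) :
      ((unitaryU α ^ m * unitaryV α ^ n : unitary (NCTorus α)) : NCTorus α) ∈ crossedTerms α :=
    ⟨n, character m, crossedTerm_character m n⟩
  have hgen : {U α, V α} ∪ star {U α, V α} ⊆ (crossedTerms α : Set (NCTorus α)) := by
    have hU := hmem 1 0
    have hV := hmem 0 1
    have hU' := hmem (-1) 0
    have hV' := hmem 0 (-1)
    simp only [zpow_zero, mul_one, one_mul, zpow_one, zpow_neg_one] at hU hV hU' hV'
    rintro x ((rfl | rfl) | (hx | hx))
    · exact hU
    · exact hV
    · rwa [← star_star x, hx]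
    · rwa [← star_star x, hx]
  refine (dense_adjoin_generators α).mono ?_
  change ((StarAlgebra.adjoin ℂ {U α, V α}).toSubalgebra : Set (NCTorus α)) ⊆ _
  rw [StarAlgebra.adjoin_toSubalgebra, ← Submonoid.closure_eq (crossedTerms α),
    ← Algebra.adjoin_eq_span]
  exact Algebra.adjoin_mono hgen

theorem clm_ext_crossedTerm {E : Type*} [AddCommMonoid E] [Module ℂ E] [TopologicalSpace E]
    [T2Space E] {S T : NCTorus α →L[ℂ] E}
    (h : ∀ n k, S (crossedTerm α n k) = T (crossedTerm α n k)) : S = T :=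
  ContinuousLinearMap.ext_on (dense_span_crossedTerms α) (by rintro _ ⟨n, k, rfl⟩; exact h n k)

end NCTorus

theorem clm_ext_toL2 {E : Type*} [AddCommMonoid E] [Module ℂ E] [TopologicalSpace E]
    [T2Space E] {S T : Lp ℂ 2 circleMeasure →L[ℂ] E}
    (h : ∀ k, S (toL2 k) = T (toL2 k)) : S = T :=
  ContinuousLinearMap.ext fun g =>
    congrFun (denseRange_toL2.equalizer S.continuous T.continuous (funext h)) g

theorem clm_ext_toL2_character {E : Type*} [AddCommMonoid E] [Module ℂ E] [TopologicalSpace E]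
    [T2Space E] {S T : Lp ℂ 2 circleMeasure →L[ℂ] E}
    (h : ∀ m, S (toL2 (character m)) = T (toL2 (character m))) : S = T :=
  clm_ext_toL2 (DFunLike.congr_fun (clm_ext_character (S := S ∘L toL2) (T := T ∘L toL2) h))

section TwistedKoopman

variable (β : ℝ) (F : C(Circle, ℂ)) (hF : ∀ z, ‖F z‖ = 1)

/-- The twisted Koopman operator `g ↦ (g ∘ R_β) F` on `L²(𝕋)`. -/
def twistedKoopman : Lp ℂ 2 circleMeasure →ₗᵢ[ℂ] Lp ℂ 2 circleMeasure :=
  weightedComposition (measurePreserving_rotation β) F.continuous.aestronglyMeasurable hF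

theorem coeFn_twistedKoopman (g : Lp ℂ 2 circleMeasure) :
    twistedKoopman β F hF g =ᵐ[circleMeasure] fun z => g (NCTorus.rotation β z) * F z :=
  coeFn_weightedComposition _ _ hF g

theorem twistedKoopman_eq_iff {g h : Lp ℂ 2 circleMeasure} :
    twistedKoopman β F hF g = h ↔
      ∀ᵐ z ∂circleMeasure, g (NCTorus.rotation β z) * F z = h z :=
  weightedComposition_eq_iff _ _ hF

theorem twistedKoopman_toL2 (h : C(Circle, ℂ)) :
    twistedKoopman β F hF (toL2 h) = toL2 (rotate β h * F) := by
  rw [twistedKoopman_eq_iff]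
  filter_upwards [ContinuousMap.coeFn_toLp (𝕜 := ℂ) (p := 2) circleMeasure (rotate β h * F),
    (measurePreserving_rotation β).quasiMeasurePreserving.ae
      (ContinuousMap.coeFn_toLp (𝕜 := ℂ) (p := 2) circleMeasure h)] with z hz hRz
  rw [hz, hRz]
  rfl

end TwistedKoopman

theorem norm_character_apply (m : ℤ) (z : Circle) : ‖character m z‖ = 1 := by
  rw [character_apply, Circle.norm_coe]

theorem character_mul_character (m n : ℤ) : character m * character n = character (m + n) := by
  rw [character, character, character, zpow_add, Submonoid.coe_mul]

namespace NCTorus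

theorem orthonormal_single : Orthonormal ℂ fun p : ℤ × ℤ => (lp.single 2 p (1 : ℂ) : L2Z) :=
  let b : HilbertBasis (ℤ × ℤ) ℂ L2Z := .ofRepr (.refl ℂ L2Z)
  (funext b.repr_symm_single : (fun p => lp.single 2 p (1 : ℂ)) = b) ▸ b.orthonormal

theorem orthonormal_single_row (n : ℤ) :
    Orthonormal ℂ fun m : ℤ => (lp.single 2 (m, n) (1 : ℂ) : L2Z) :=
  orthonormal_single.comp _ (Prod.mk_left_injective n)

/-- The isometry of `L²(𝕋)` onto the row `ℓ²(ℤ × {n})` that sends the character `z ↦ zᵐ` to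
`δ_{m,n}`. -/
def row (n : ℤ) : Lp ℂ 2 circleMeasure →ₗᵢ[ℂ] L2Z :=
  (orthonormal_single_row n).orthogonalFamily.linearIsometry.comp
    characterBasis.repr.toLinearIsometry

theorem row_toL2_character (m n : ℤ) :
    row n (toL2 (character m)) = lp.single 2 (m, n) (1 : ℂ) := by
  rw [← characterBasis_apply]
  change (orthonormal_single_row n).orthogonalFamily.linearIsometry
    (characterBasis.repr (characterBasis m)) = _
  rw [HilbertBasis.repr_self, OrthogonalFamily.linearIsometry_apply_single]
  exact one_smul ℂ _

theorem vac_eq_row : vac = row 0 (toL2 1) := by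
  rw [vac, ← row_toL2_character]
  rfl

theorem inner_row_row_of_ne {m n : ℤ} (hmn : m ≠ n) (g h : Lp ℂ 2 circleMeasure) :
    ⟪row m g, row n h⟫_ℂ = 0 := by
  have hsingle (k : ℤ) : ⟪row n (toL2 (character k)), row m g⟫_ℂ = 0 := by
    refine DFunLike.congr_fun (clm_ext_toL2_character
      (S := innerSL ℂ (row n (toL2 (character k))) ∘L (row m).toContinuousLinearMap) (T := 0)
      fun l => ?_) g
    change ⟪row n (toL2 (character k)), row m (toL2 (character l))⟫_ℂ = 0
    rw [row_toL2_character, row_toL2_character]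
    exact orthonormal_single.2 fun h => hmn (congrArg Prod.snd h).symm
  exact DFunLike.congr_fun (clm_ext_toL2_character
    (S := innerSL ℂ (row m g) ∘L (row n).toContinuousLinearMap) (T := 0)
    fun k => inner_eq_zero_symm.mp (hsingle k)) h

variable {α : ℝ}

theorem trace_eq_matrixCoefficient : trace α = matrixCoefficient (regRep α) vac vac := rfl

theorem regRep_crossedTerm_character_single (k l m n : ℤ) :
    regRep α (crossedTerm α n (character m)) (lp.single 2 (k, l) (1 : ℂ)) =
      ((Circle.exp (2 * Real.pi * -(n * α)) ^ k : Circle) : ℂ) •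
        lp.single 2 (m + k, n + l) (1 : ℂ) := by
  rw [crossedTerm_character, regRep_monomial]
  ext p
  rw [regU_zpow, regV_zpow, lp.coeFn_smul, Pi.smul_apply, smul_eq_mul]
  by_cases hp : p = (m + k, n + l)
  · have hp' : ((m + k - m, n + l - n) : ℤ × ℤ) = (k, l) := by simp
    rw [hp, hp', lp.single_apply_self, lp.single_apply_self, add_sub_cancel_left,
      ← Circle.exp_zsmul, ← Circle.exp_zsmul]
    congr 3
    rw [zsmul_eq_mul, zsmul_eq_mul]
    ring
  · have hp' : (p.1 - m, p.2 - n) ≠ (k, l) := fun h => hp (by grind)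
    rw [lp.single_apply_ne _ _ _ hp, lp.single_apply_ne _ _ _ hp', mul_zero, mul_zero]

theorem regRep_crossedTerm_vac (n : ℤ) (h : C(Circle, ℂ)) :
    regRep α (crossedTerm α n h) vac = row n (toL2 h) := by
  refine DFunLike.congr_fun (clm_ext_character
    (S := ContinuousLinearMap.apply ℂ L2Z vac ∘L
      ⟨(regRep α).toAlgHom.toLinearMap, continuous_starAlgHom _⟩ ∘L crossedTerm α n)
    (T := (row n).toContinuousLinearMap ∘L toL2) fun m => ?_) h
  change regRep α (crossedTerm α n (character m)) vac = row n (toL2 (character m))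
  rw [vac, regRep_crossedTerm_character_single, row_toL2_character, zpow_zero, Circle.coe_one,
    one_smul, add_zero, add_zero]

theorem regRep_crossedTerm_character_row (l m n : ℤ) (g : Lp ℂ 2 circleMeasure) :
    regRep α (crossedTerm α l (character m)) (row n g) =
      row (l + n) (twistedKoopman (-(l * α)) (character m) (norm_character_apply m) g) := by
  let T := twistedKoopman (-(l * α)) (character m) (norm_character_apply m)
  refine DFunLike.congr_fun (clm_ext_toL2_character
    (S := regRep α (crossedTerm α l (character m)) ∘L (row n).toContinuousLinearMap)
    (T := ((row (l + n)).comp T).toContinuousLinearMap) fun k => ?_) g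
  change regRep α (crossedTerm α l (character m)) (row n (toL2 (character k))) =
    row (l + n) (T (toL2 (character k)))
  rw [row_toL2_character, regRep_crossedTerm_character_single, twistedKoopman_toL2,
    rotate_character, smul_mul_assoc, character_mul_character, map_smul, map_smul,
    row_toL2_character, add_comm k]

theorem matrixCoefficient_row_vac_crossedTerm (n : ℤ) (g : Lp ℂ 2 circleMeasure)
    (h : C(Circle, ℂ)) :
    matrixCoefficient (regRep α) (row n g) vac (crossedTerm α n h) = ⟪g, toL2 h⟫_ℂ := by
  rw [matrixCoefficient_apply, regRep_crossedTerm_vac, LinearIsometry.inner_map_map]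

theorem matrixCoefficient_row_vac_crossedTerm_of_ne {l n : ℤ} (hln : l ≠ n)
    (g : Lp ℂ 2 circleMeasure) (h : C(Circle, ℂ)) :
    matrixCoefficient (regRep α) (row n g) vac (crossedTerm α l h) = 0 := by
  rw [matrixCoefficient_apply, regRep_crossedTerm_vac, inner_row_row_of_ne hln.symm]

theorem matrixCoefficient_vac_row_crossedTerm {l n : ℤ} (hln : l + n ≠ 0)
    (g : Lp ℂ 2 circleMeasure) (h : C(Circle, ℂ)) :
    matrixCoefficient (regRep α) vac (row n g) (crossedTerm α l h) = 0 := by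
  refine DFunLike.congr_fun (clm_ext_character
    (S := matrixCoefficient (regRep α) vac (row n g) ∘L crossedTerm α l) (T := 0)
    fun m => ?_) h
  change matrixCoefficient (regRep α) vac (row n g) (crossedTerm α l (character m)) = 0
  rw [matrixCoefficient_apply, regRep_crossedTerm_character_row, vac_eq_row,
    inner_row_row_of_ne hln.symm]

theorem matrixCoefficient_row_row (n : ℤ) {g : Lp ℂ 2 circleMeasure} {c : ℝ}
    (hg : ∀ᵐ z ∂circleMeasure, ‖g z‖ = c) :
    matrixCoefficient (regRep α) (row n g) (row n g) = (c : ℂ) ^ 2 • trace α := by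
  refine clm_ext_crossedTerm fun l => DFunLike.congr_fun (clm_ext_character
    (S := matrixCoefficient (regRep α) (row n g) (row n g) ∘L crossedTerm α l)
    (T := ((c : ℂ) ^ 2 • trace α) ∘L crossedTerm α l) fun m => ?_)
  change ⟪row n g, regRep α (crossedTerm α l (character m)) (row n g)⟫_ℂ =
    (c : ℂ) ^ 2 * ⟪vac, regRep α (crossedTerm α l (character m)) vac⟫_ℂ
  rw [regRep_crossedTerm_character_row, regRep_crossedTerm_vac, vac_eq_row]
  rcases eq_or_ne l 0 with rfl | hl
  · rw [zero_add, LinearIsometry.inner_map_map, LinearIsometry.inner_map_map, inner_toL2,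
      L2.inner_def, ← integral_const_mul]
    refine integral_congr_ae ?_
    filter_upwards [hg, coeFn_twistedKoopman (-((0 : ℤ) * α)) (character m)
      (norm_character_apply m) g] with z hz hT
    rw [hT, Int.cast_zero, zero_mul, neg_zero, rotation_zero, RCLike.inner_apply, mul_right_comm,
      RCLike.mul_conj, hz, ContinuousMap.one_apply, map_one, mul_one]
    rfl
  · rw [inner_row_row_of_ne (by grind), inner_row_row_of_ne hl.symm, mul_zero]

variable {θ : ℝ} {f : C(Circle, Circle)}

theorem cocycle_zero (z : Circle) : cocycle α f 0 z = 1 := by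
  rw [cocycle, if_pos le_rfl, Int.natAbs_zero, Finset.prod_range_zero]

theorem cocycle_add_one (n : ℤ) (z : Circle) :
    cocycle α f (n + 1) z = cocycle α f n z * f (rotation (-(n * α)) z) := by
  obtain ⟨k, rfl | rfl⟩ : ∃ k : ℕ, n = k ∨ n = -(k + 1) :=
    ⟨if 0 ≤ n then n.toNat else (-n - 1).toNat, by grind⟩
  · rw [← Nat.cast_succ, cocycle, cocycle, if_pos (Int.natCast_nonneg _),
      if_pos (Int.natCast_nonneg _), Int.natAbs_natCast, Int.natAbs_natCast,
      Finset.prod_range_succ, Int.cast_natCast]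
  · have hnat : (-((k : ℤ) + 1)).natAbs = k + 1 := by omega
    have hzpow : cocycle α f (-k) z = ∏ l ∈ Finset.Icc 1 k, conj (f (rotation (l * α) z) : ℂ) := by
      rcases k.eq_zero_or_pos with rfl | hk
      · exact cocycle_zero z
      · rw [cocycle, if_neg (by omega), Int.natAbs_neg, Int.natAbs_natCast]
    have hangle : -(((-((k : ℤ) + 1) : ℤ) : ℝ) * α) = ((k + 1 : ℕ) : ℝ) * α := by
      push_cast
      ring
    rw [neg_add, neg_add_cancel_right, ← neg_add, hzpow, cocycle, if_neg (by omega), hnat,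
      Finset.prod_Icc_succ_top (by omega), hangle, mul_assoc, ← Circle.coe_inv_eq_conj,
      ← Circle.coe_mul, inv_mul_cancel, Circle.coe_one, mul_one]

theorem norm_cocycle (n : ℤ) (z : Circle) : ‖cocycle α f n z‖ = 1 := by
  unfold cocycle
  split_ifs <;> simp only [norm_prod, RCLike.norm_conj, Circle.norm_coe, Finset.prod_const_one]

theorem continuous_cocycle (n : ℤ) : Continuous (cocycle α f n) := by
  have hf (β : ℝ) : Continuous fun z => (f (rotation β z) : ℂ) :=
    continuous_subtype_val.comp (f.continuous.comp (continuous_rotation β))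
  unfold cocycle
  split_ifs
  · exact continuous_finsetProd _ fun l _ => hf _
  · exact continuous_finsetProd _ fun l _ => Complex.continuous_conj.comp (hf _)

variable (α θ f) in
/-- The cohomological equation `(g ∘ R_{θ/2π}) f_n = g` for `g ∈ L²(𝕋)`. -/
def IsCohomologicalSolution (n : ℤ) (g : Lp ℂ 2 circleMeasure) : Prop :=
  ∀ᵐ z ∂circleMeasure, g (rotation (θ / (2 * Real.pi)) z) * cocycle α f n z = g z

variable (α f) in
/-- The twisted cocycle product `f_n` as an element of `C(𝕋)`. -/
def cocycleMap (n : ℤ) : C(Circle, ℂ) := ⟨cocycle α f n, continuous_cocycle n⟩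

theorem norm_cocycleMap (n : ℤ) (z : Circle) : ‖cocycleMap α f n z‖ = 1 := norm_cocycle n z

theorem cocycleMap_zero : cocycleMap α f 0 = 1 :=
  ContinuousMap.ext fun z => cocycle_zero (α := α) (f := f) z

theorem cocycleMap_add_one (n : ℤ) :
    cocycleMap α f (n + 1) = cocycleMap α f n *
      rotate (-(n * α)) (ContinuousMap.comp ⟨(↑), continuous_subtype_val⟩ f) :=
  ContinuousMap.ext (cocycle_add_one n)

theorem anzai_circleCFC (h : C(Circle, ℂ)) :
    anzai α θ f (circleCFC (unitaryU α) h) =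
      circleCFC (unitaryU α) (rotate (θ / (2 * Real.pi)) h) := by
  refine map_circleCFC_eq_rotate (anzai α θ f : NCTorus α →⋆ₐ[ℂ] NCTorus α) ?_ h
  rw [mul_div_cancel₀ θ Real.two_pi_pos.ne']
  exact anzai_U α θ f

theorem anzai_unitaryV_zpow (n : ℤ) :
    anzai α θ f (unitaryV α ^ n : unitary (NCTorus α)) = crossedTerm α n (cocycleMap α f n) := by
  let v : (NCTorus α)ˣ := Units.map (anzai α θ f : NCTorus α →* NCTorus α)
    (Unitary.toUnits (unitaryV α))
  have hv : (v : NCTorus α) =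
      crossedTerm α 1 (ContinuousMap.comp ⟨(↑), continuous_subtype_val⟩ f) := by
    rw [crossedTerm_apply, circleCFC_coe_comp, zpow_one]
    exact anzai_V α θ f
  have hpow := eq_zpow_of_add_one (w := fun n => crossedTerm α n (cocycleMap α f n)) (a := v)
    (by rw [cocycleMap_zero, crossedTerm_zero_one])
    (fun n => by rw [hv, crossedTerm_mul_crossedTerm, ← cocycleMap_add_one]) n
  rw [hpow, ← map_zpow, ← map_zpow]
  rfl

theorem anzai_crossedTerm (n : ℤ) (h : C(Circle, ℂ)) :
    anzai α θ f (crossedTerm α n h) =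
      crossedTerm α n (rotate (θ / (2 * Real.pi)) h * cocycleMap α f n) := by
  rw [crossedTerm_apply, map_mul, anzai_circleCFC, anzai_unitaryV_zpow, crossedTerm_apply,
    crossedTerm_apply, map_mul, mul_assoc]

theorem inner_toL2_anzai_iff (n : ℤ) (g : Lp ℂ 2 circleMeasure) :
    (∀ h, ⟪g, toL2 (rotate (θ / (2 * Real.pi)) h * cocycleMap α f n)⟫_ℂ = ⟪g, toL2 h⟫_ℂ) ↔
      IsCohomologicalSolution α θ f n g := by
  let T := twistedKoopman (θ / (2 * Real.pi)) (cocycleMap α f n) (norm_cocycleMap n)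
  have h := inner_apply_eq_iff_apply_eq_self T denseRange_toL2 (g := g)
  rw [Set.forall_mem_range] at h
  simp only [T, twistedKoopman_toL2, twistedKoopman_eq_iff] at h
  exact h

theorem matrixCoefficient_row_vac_anzai_iff (n : ℤ) (g : Lp ℂ 2 circleMeasure) :
    (∀ a, matrixCoefficient (regRep α) (row n g) vac (anzai α θ f a) =
        matrixCoefficient (regRep α) (row n g) vac a) ↔
      IsCohomologicalSolution α θ f n g := by
  rw [← inner_toL2_anzai_iff]
  refine ⟨fun hinv h => ?_, fun hinner a => ?_⟩
  · rw [← matrixCoefficient_row_vac_crossedTerm (α := α), ← anzai_crossedTerm, hinv,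
      matrixCoefficient_row_vac_crossedTerm]
  · refine DFunLike.congr_fun (clm_ext_crossedTerm
      (S := matrixCoefficient (regRep α) (row n g) vac ∘L
        ⟨(anzai α θ f : NCTorus α →⋆ₐ[ℂ] NCTorus α).toAlgHom.toLinearMap, continuous_starAlgHom _⟩)
      (T := matrixCoefficient (regRep α) (row n g) vac) fun l h => ?_) a
    change matrixCoefficient (regRep α) (row n g) vac (anzai α θ f (crossedTerm α l h)) =
      matrixCoefficient (regRep α) (row n g) vac (crossedTerm α l h)
    rw [anzai_crossedTerm]
    rcases eq_or_ne l n with rfl | hln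
    · rw [matrixCoefficient_row_vac_crossedTerm, matrixCoefficient_row_vac_crossedTerm, hinner]
    · rw [matrixCoefficient_row_vac_crossedTerm_of_ne hln,
        matrixCoefficient_row_vac_crossedTerm_of_ne hln]

theorem trace_mem_invariantStates : trace α ∈ invariantStates (anzai α θ f) := by
  refine ⟨⟨?_, fun a => ?_⟩, ?_⟩
  · have h := trace_monomial α 0 0
    rwa [zpow_zero, zpow_zero, one_mul, OneMemClass.coe_one, if_pos ⟨rfl, rfl⟩] at h
  · rw [trace_eq_matrixCoefficient, matrixCoefficient_self_star_mul_self]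
    exact_mod_cast sq_nonneg ‖regRep α a vac‖
  · have hfix : twistedKoopman (θ / (2 * Real.pi)) (cocycleMap α f 0) (norm_cocycleMap 0)
        (toL2 1) = toL2 1 := by
      rw [twistedKoopman_toL2, map_one, one_mul, cocycleMap_zero]
    have hinv := (matrixCoefficient_row_vac_anzai_iff (α := α) (f := f) 0 (toL2 1)).mpr
      ((twistedKoopman_eq_iff _ _ _).mp hfix)
    rwa [← vac_eq_row] at hinv

theorem matrixCoefficient_vac_crossedTerm (η : L2Z) (n : ℤ) (h : C(Circle, ℂ)) :
    matrixCoefficient (regRep α) η vac (crossedTerm α n h) =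
      ⟪(row n).toContinuousLinearMap.adjoint η, toL2 h⟫_ℂ := by
  rw [matrixCoefficient_apply, regRep_crossedTerm_vac, ContinuousLinearMap.adjoint_inner_left]
  rfl

theorem trace_crossedTerm_zero (h : C(Circle, ℂ)) :
    trace α (crossedTerm α 0 h) = ⟪toL2 1, toL2 h⟫_ℂ := by
  rw [← matrixCoefficient_row_vac_crossedTerm (α := α), ← vac_eq_row]
  rfl

theorem trace_crossedTerm_of_ne {n : ℤ} (hn : n ≠ 0) (h : C(Circle, ℂ)) :
    trace α (crossedTerm α n h) = 0 := by
  rw [← matrixCoefficient_row_vac_crossedTerm_of_ne hn (toL2 1) h, ← vac_eq_row]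
  rfl

theorem exists_eq_smul_toL2_one {β : ℝ} (hβ : Ergodic (rotation β) circleMeasure)
    {g : Lp ℂ 2 circleMeasure} (hg : ∀ᵐ z ∂circleMeasure, g (rotation β z) = g z) :
    ∃ c : ℂ, g = c • toL2 1 := by
  obtain ⟨c, hc⟩ := hβ.ae_eq_const_of_ae_eq_comp_ae (Lp.aestronglyMeasurable g) hg
  refine ⟨c, Lp.ext ?_⟩
  filter_upwards [hc, Lp.coeFn_smul c (toL2 1),
    ContinuousMap.coeFn_toLp (𝕜 := ℂ) (p := 2) circleMeasure (1 : C(Circle, ℂ))]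
    with z hz hsmul hone
  rw [hz, hsmul, Pi.smul_apply]
  change c = c • ContinuousMap.toLp 2 circleMeasure ℂ 1 z
  rw [hone, ContinuousMap.one_apply, smul_eq_mul, mul_one]

theorem matrixCoefficient_vac_eq_trace
    (hR : Ergodic (rotation (θ / (2 * Real.pi))) circleMeasure)
    (hsol : ∀ n : ℤ, n ≠ 0 → ∀ g, IsCohomologicalSolution α θ f n g → g = 0)
    {η : L2Z} (hη : matrixCoefficient (regRep α) η vac ∈ invariantStates (anzai α θ f)) :
    matrixCoefficient (regRep α) η vac = trace α := by
  let g (n : ℤ) : Lp ℂ 2 circleMeasure := (row n).toContinuousLinearMap.adjoint η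
  have hinner (n : ℤ) (h : C(Circle, ℂ)) :
      matrixCoefficient (regRep α) η vac (crossedTerm α n h) = ⟪g n, toL2 h⟫_ℂ :=
    matrixCoefficient_vac_crossedTerm η n h
  have hg (n : ℤ) : IsCohomologicalSolution α θ f n (g n) := by
    refine (inner_toL2_anzai_iff n (g n)).mp fun h => ?_
    rw [← hinner, ← hinner, ← anzai_crossedTerm, hη.2]
  obtain ⟨c, hc⟩ : ∃ c : ℂ, g 0 = c • toL2 1 :=
    exists_eq_smul_toL2_one hR (by
      simpa only [IsCohomologicalSolution, cocycle_zero, mul_one] using hg 0)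
  have hrow (h : C(Circle, ℂ)) : matrixCoefficient (regRep α) η vac (crossedTerm α 0 h) =
      conj c * trace α (crossedTerm α 0 h) := by
    rw [hinner, trace_crossedTerm_zero, ← inner_smul_left, ← hc]
  have hc1 : conj c = 1 := by
    have h1 := hrow 1
    rw [crossedTerm_zero_one, hη.1.1, (trace_mem_invariantStates (θ := θ) (f := f)).1.1] at h1
    rw [h1, mul_one]
  refine clm_ext_crossedTerm fun n h => ?_
  rcases eq_or_ne n 0 with rfl | hn
  · rw [hrow, hc1, one_mul]
  · rw [hinner, trace_crossedTerm_of_ne hn, hsol n hn _ (hg n),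
      inner_zero_left]

theorem isErgodicSystem_anzai_of_forall_eq_zero
    (hR : Ergodic (rotation (θ / (2 * Real.pi))) circleMeasure)
    (hsol : ∀ n : ℤ, n ≠ 0 → ∀ g, IsCohomologicalSolution α θ f n g → g = 0) :
    IsErgodicSystem (anzai α θ f) (trace α) := by
  refine isErgodicSystem_of_forall_dominated trace_mem_invariantStates ?_
  rintro φ hφ ⟨C, hC⟩
  obtain ⟨η, rfl⟩ := hφ.1.exists_eq_matrixCoefficient (regRep α) (Ω := vac) (C := C) fun y => by
    have h := hC y
    rw [trace_eq_matrixCoefficient, matrixCoefficient_self_star_mul_self] at h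
    exact_mod_cast h
  exact matrixCoefficient_vac_eq_trace hR hsol hφ

theorem eq_zero_of_isErgodicSystem_anzai
    (hR : Ergodic (rotation (θ / (2 * Real.pi))) circleMeasure)
    (herg : IsErgodicSystem (anzai α θ f) (trace α)) {n : ℤ} (hn : n ≠ 0)
    {g : Lp ℂ 2 circleMeasure} (hg : IsCohomologicalSolution α θ f n g) : g = 0 := by
  obtain ⟨c, hc⟩ := exists_norm_ae_eq_const_of_ergodic hR (norm_cocycle n)
    (Lp.aestronglyMeasurable g) hg
  have hvector := matrixCoefficient_row_row (α := α) n hc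
  have hnorm : (c : ℂ) ^ 2 = (‖row n g‖ : ℂ) ^ 2 := by
    have h1 := DFunLike.congr_fun hvector 1
    rw [matrixCoefficient_apply, map_one, one_apply_eq_self, inner_self_eq_norm_sq_to_K, smul_apply,
      herg.1.1.1, smul_eq_mul, mul_one] at h1
    exact h1.symm
  rw [hnorm] at hvector
  have horth : ⟪vac, row n g⟫_ℂ = 0 := by rw [vac_eq_row, inner_row_row_of_ne hn.symm]
  have hcross := IsErgodicSystem.matrixCoefficient_cross_eq_zero herg horth hvector
    ((matrixCoefficient_row_vac_anzai_iff n g).mpr hg)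
  refine denseRange_toL2.eq_zero_of_inner_left ℂ fun h => ?_
  have hcross_h := DFunLike.congr_fun hcross (crossedTerm α n h)
  rwa [add_apply, matrixCoefficient_vac_row_crossedTerm (by grind), zero_add,
    matrixCoefficient_row_vac_crossedTerm] at hcross_h

end NCTorus

end

theorem mainTheorem3 (α θ : ℝ) (hθ : Irrational (θ / (2 * Real.pi))) (f : C(Circle, Circle)) :
    IsErgodicSystem (NCTorus.anzai α θ f) (NCTorus.trace α) ↔
      ∀ n : ℤ, n ≠ 0 → ∀ g : MeasureTheory.Lp ℂ 2 circleMeasure,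
        (∀ᵐ z ∂circleMeasure,
          g (NCTorus.rotation (θ / (2 * Real.pi)) z) * NCTorus.cocycle α f n z = g z) →
        g = 0 :=
  ⟨fun herg _ hn _ => NCTorus.eq_zero_of_isErgodicSystem_anzai (ergodic_rotation hθ) herg hn,
    NCTorus.isErgodicSystem_anzai_of_forall_eq_zero (ergodic_rotation hθ)⟩
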